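/- Let $d\in\mathbb N$ and let $D[0,1]$ be the set of functions $f:[0,1]\to\mathbb R^d$ that are right continuous with left limits and left continuous at $1$, equipped with the $J_1$ metric $$d_{J_1}(f,g)=\inf_{\lambda}\bigl\{\|f\circ\lambda-g\|_\infty\vee\|\lambda-\mathrm{id}\|_\infty\bigr\},$$ the infimum being over all continuous bijections $\lambda:[0,1]\to[0,1]$, and with its Borel $\sigma$-algebra. Convergence in distribution w.r.t. $J_1$ of $D[0,1]$-valued random variables means $\mathbb E\,G(X^{(n)})\to\mathbb E\,G(X)$ for all bounded $J_1$-continuous $G:D[0,1]\to\mathbb R$. On a probability space $(\Omega,\mathcal A,\mathbb P)$ let, for every $n$, $Y^{(n)}=(Y^{(n)}_0,Y^{(n)}_1,\dots)$ be a time homogeneous Markov chain in $\mathbb R^d$, and let $(N_t)_{t\ge0}$ be a Poisson process with intensity $1$ that is independent of $Y^{(n)}$ for every $n$. Write $N_{t-}$ for its left limit at $t$. Define $D[0,1]$-valued random variables by $$X^{n,J_1}_t:=Y^{(n)}_{\lfloor nt\rfloor},\qquad Z^{(n)}_t:=Y^{(n)}_{N_{nt}}\qquad(t\in[0,1)),\qquad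 X^{n,J_1}_1:=X^{n,J_1}_{1-},\quad Z^{(n)}_1:=Z^{(n)}_{1-}.$$ Assume that $$\sup_{k<|n-1-N_{n-}|}\Bigl|Y^{(n)}_{((n-1)\wedge N_{n-})+k}-Y^{(n)}_{(n-1)\wedge N_{n-}}\Bigr|\longrightarrow0\quad\text{in probability as } n\to\infty,$$ where $k$ ranges over integers $k\ge 0$ and the supremum over the empty set is $0$. Then $X^{n,J_1}$ converges in distribution w.r.t. $J_1$ as $n\to\infty$ if and only if $Z^{(n)}$ converges in distribution w.r.t. $J_1$. Moreover the limits agree: for every probability measure $L$ on $D[0,1]$, $X^{n,J_1}$ converges in distribution w.r.t. $J_1$ to $L$ if and only if $Z^{(n)}$ does. -/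

import Mathlib

open MeasureTheory ProbabilityTheory Filter Set
open scoped Topology NNReal ENNReal unitInterval

/-- The Skorokhod space `D[0,1]`: functions on `[0,1]` that are right continuous with left limits
and left continuous at `1`. -/
structure SkorokhodSpace (E : Type*) [TopologicalSpace E] where
  toFun : I → E
  right_continuous : ∀ t, ContinuousWithinAt toFun (Ici t) t
  exists_left_limit : ∀ t, ∃ l, Tendsto toFun (𝓝[<] t) (𝓝 l)
  left_continuous_one : Tendsto toFun (𝓝[<] 1) (𝓝 (toFun 1))

namespace SkorokhodSpace

instance {E : Type*} [TopologicalSpace E] : CoeFun (SkorokhodSpace E) (fun _ => I → E) :=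
  ⟨SkorokhodSpace.toFun⟩

section Metric

variable {E : Type*} [PseudoEMetricSpace E]

/-- The cost `‖f ∘ l - g‖_∞ ∨ ‖l - id‖_∞` of a continuous bijection `l` of `[0,1]`; since `[0,1]` is
compact and Hausdorff, the continuous bijections are exactly the homeomorphisms. -/
noncomputable def timeChangeCost (f g : SkorokhodSpace E) (l : I ≃ₜ I) : ℝ≥0∞ :=
  (⨆ t, edist (f (l t)) (g t)) ⊔ (⨆ t, edist (l t) t)

/-- The distance `d_{J₁}`, the infimum of the costs of all time changes. -/
noncomputable def distJ1 (f g : SkorokhodSpace E) : ℝ≥0∞ :=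
  ⨅ l : I ≃ₜ I, timeChangeCost f g l

theorem distJ1_self (f : SkorokhodSpace E) : distJ1 f f = 0 := by
  refine le_antisymm ((iInf_le _ (Homeomorph.refl I)).trans ?_) zero_le
  simp [timeChangeCost]

theorem distJ1_le_swap (f g : SkorokhodSpace E) : distJ1 f g ≤ distJ1 g f := by
  refine le_iInf fun l => (iInf_le _ l.symm).trans ?_
  refine sup_le_sup (iSup_le fun t => ?_) (iSup_le fun t => ?_)
  · refine le_trans ?_ (le_iSup (fun s => edist (g (l s)) (f s)) (l.symm t))
    simp [edist_comm]
  · refine le_trans ?_ (le_iSup (fun s => edist (l s) s) (l.symm t))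
    simp [edist_comm]

theorem distJ1_comm (f g : SkorokhodSpace E) : distJ1 f g = distJ1 g f :=
  le_antisymm (distJ1_le_swap f g) (distJ1_le_swap g f)

theorem timeChangeCost_trans (f g h : SkorokhodSpace E) (l m : I ≃ₜ I) :
    timeChangeCost f h (m.trans l) ≤ timeChangeCost f g l + timeChangeCost g h m := by
  refine sup_le (iSup_le fun t => ?_) (iSup_le fun t => ?_)
  · exact (edist_triangle _ (g (m t)) _).trans (add_le_add
      ((le_iSup (fun s => edist (f (l s)) (g s)) (m t)).trans le_sup_left)
      ((le_iSup (fun s => edist (g (m s)) (h s)) t).trans le_sup_left))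
  · exact (edist_triangle _ (m t) _).trans (add_le_add
      ((le_iSup (fun s => edist (l s) s) (m t)).trans le_sup_right)
      ((le_iSup (fun s => edist (m s) s) t).trans le_sup_right))

theorem distJ1_triangle (f g h : SkorokhodSpace E) : distJ1 f h ≤ distJ1 f g + distJ1 g h :=
  ENNReal.le_iInf_add_iInf fun l m => (iInf_le _ (m.trans l)).trans (timeChangeCost_trans f g h l m)

/-- `D[0,1]` carries the `J₁` topology, the one induced by `d_{J₁}`. -/
noncomputable instance : PseudoEMetricSpace (SkorokhodSpace E) where
  edist := distJ1
  edist_self := distJ1_self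
  edist_comm := distJ1_comm
  edist_triangle := distJ1_triangle

/-- The Borel σ-algebra of the `J₁` topology. -/
noncomputable instance : MeasurableSpace (SkorokhodSpace E) := borel _

instance : BorelSpace (SkorokhodSpace E) := ⟨rfl⟩

end Metric

/-- The element of `D[0,1]` that agrees with the rcll path `f` on `[0,1)` and has the value
`f(1-)` at `1`. -/
noncomputable def ofRcll {E : Type*} [TopologicalSpace E] (f : ℝ≥0 → E)
    (hr : ∀ t, ContinuousWithinAt f (Ici t) t) (hl : ∀ t, ∃ l, Tendsto f (𝓝[<] t) (𝓝 l)) :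
    SkorokhodSpace E :=
  have left (t : I) : Tendsto unitInterval.toNNReal (𝓝[<] t) (𝓝[<] (unitInterval.toNNReal t)) :=
    tendsto_nhdsWithin_iff.2
      ⟨(unitInterval.toNNReal_continuous.tendsto t).mono_left nhdsWithin_le_nhds,
        eventually_mem_nhdsWithin.mono fun _ hs => hs⟩
  have leftEq (t : I) :
      (fun s : I => f (unitInterval.toNNReal s)) =ᶠ[𝓝[<] t]
        fun s => if s < 1 then f (unitInterval.toNNReal s) else f.leftLim 1 :=
    eventually_mem_nhdsWithin.mono fun s (hs : s < t) => by
      simp only [if_pos (lt_of_lt_of_le hs unitInterval.le_one')]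
  { toFun := fun t => if t < 1 then f (unitInterval.toNNReal t) else f.leftLim 1
    right_continuous := by
      intro t
      rcases lt_or_eq_of_le (unitInterval.le_one' (t := t)) with ht | rfl
      · have h : Tendsto unitInterval.toNNReal (𝓝[≥] t) (𝓝[≥] unitInterval.toNNReal t) :=
          tendsto_nhdsWithin_iff.2
            ⟨(unitInterval.toNNReal_continuous.tendsto t).mono_left nhdsWithin_le_nhds,
              eventually_mem_nhdsWithin.mono fun _ hs => hs⟩
        refine ContinuousWithinAt.congr_of_eventuallyEq (f := fun s : I => f (unitInterval.toNNReal s))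
          ((hr (unitInterval.toNNReal t)).tendsto.comp h) ?_ (by simp [ht])
        filter_upwards [mem_nhdsWithin_of_mem_nhds (Iio_mem_nhds ht)] with s hs
        exact if_pos hs
      · have : Ici (1 : I) = {1} := by
          ext s
          simp [le_antisymm_iff, unitInterval.le_one']
        rw [this]
        exact continuousWithinAt_singleton
    exists_left_limit := fun t =>
      let ⟨l, h⟩ := hl (unitInterval.toNNReal t)
      ⟨l, (h.comp (left t)).congr' (leftEq t)⟩
    left_continuous_one := by
      have h := (tendsto_leftLim_of_tendsto (hl (unitInterval.toNNReal 1))).comp (left 1)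
      simpa using h.congr' (leftEq 1) }

/-- The path `t ↦ y (c t)` of a sequence `y` along a right continuous nondecreasing clock `c` with
values in `ℕ`, as an element of `D[0,1]`. -/
noncomputable def subordinate {E : Type*} [TopologicalSpace E] (y : ℕ → E) (c : ℝ≥0 → ℕ)
    (hm : Monotone c) (hc : ∀ t, ContinuousWithinAt c (Ici t) t) : SkorokhodSpace E :=
  ofRcll (fun t => y (c t))
    (fun t => (continuous_of_discreteTopology (f := y)).continuousAt.comp_continuousWithinAt (hc t))
    (fun t => ⟨y (c.leftLim t),
      ((continuous_of_discreteTopology (f := y)).tendsto _).comp (hm.tendsto_leftLim t)⟩)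

end SkorokhodSpace

theorem floorClock_monotone (n : ℕ) : Monotone (fun t : ℝ≥0 => ⌊(n : ℝ≥0) * t⌋₊) :=
  fun _ _ h => Nat.floor_mono (mul_le_mul_right h _)

theorem floorClock_rightContinuous (n : ℕ) (t : ℝ≥0) :
    ContinuousWithinAt (fun t : ℝ≥0 => ⌊(n : ℝ≥0) * t⌋₊) (Ici t) t := by
  have h1 : ContinuousAt (fun s : ℝ≥0 => (n : ℝ≥0) * s) t := by fun_prop
  have h2 : ∀ᶠ s in 𝓝[≥] t, (n : ℝ≥0) * s < ⌊(n : ℝ≥0) * t⌋₊ + 1 :=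
    nhdsWithin_le_nhds (h1.eventually_lt continuousAt_const (Nat.lt_floor_add_one _))
  refine (continuousWithinAt_const (b := ⌊(n : ℝ≥0) * t⌋₊)).congr_of_eventuallyEq ?_ rfl
  filter_upwards [h2, eventually_mem_nhdsWithin] with s hs hts
  refine le_antisymm (Nat.lt_succ_iff.1 ?_) (floorClock_monotone n hts)
  rw [Nat.floor_lt' (Nat.succ_ne_zero _)]
  exact_mod_cast hs

section Processes

variable {Ω : Type*} [MeasurableSpace Ω]

/-- A Poisson process with intensity `r`: a counting process (started at `0`, nondecreasing and
right continuous) with independent increments, the increment over `(s,t]` having the Poisson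
distribution with parameter `r (t - s)`. -/
structure IsPoissonProcess (r : ℝ≥0) (N : ℝ≥0 → Ω → ℕ) (P : Measure Ω) : Prop where
  measurable : ∀ t, Measurable (N t)
  zero : ∀ ω, N 0 ω = 0
  monotone : ∀ ω, Monotone (fun t => N t ω)
  right_continuous : ∀ ω t, ContinuousWithinAt (fun t => N t ω) (Ici t) t
  indep_increments : HasIndepIncrements N P
  law_increment : ∀ s t, s ≤ t →
    P.map (fun ω => N t ω - N s ω) = poissonMeasure (r * (t - s))

/-- A time homogeneous Markov chain in discrete time: there is one transition kernel `κ` such that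
the conditional law of `Y (k+1)` given `Y 0, …, Y k` is `κ (Y k)`, for every `k`. -/
structure IsHomogeneousMarkovChain {E : Type*} [MeasurableSpace E] (Y : ℕ → Ω → E)
    (P : Measure Ω) : Prop where
  measurable : ∀ k, Measurable (Y k)
  markov : ∃ κ : Kernel E E, IsMarkovKernel κ ∧ ∀ (k : ℕ) (A : Set E), MeasurableSet A →
    P[(Y (k + 1) ⁻¹' A).indicator (fun _ => (1 : ℝ)) |
        ⨆ j ∈ Iic k, MeasurableSpace.comap (Y j) inferInstance]
      =ᵐ[P] fun ω => (κ (Y k ω)).real A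

/-- The step embedding `X^{n,J₁}` of a discrete time process: `X_t = Y_{⌊nt⌋}` for `t < 1`, and
`X_1 = X_{1-}`. -/
noncomputable def stepEmbedding {E : Type*} [TopologicalSpace E] (Y : ℕ → Ω → E) (n : ℕ) (ω : Ω) :
    SkorokhodSpace E :=
  SkorokhodSpace.subordinate (fun k => Y k ω) (fun t => ⌊(n : ℝ≥0) * t⌋₊)
    (floorClock_monotone n) (floorClock_rightContinuous n)

/-- The Markov embedding `Z^{(n)}` of a discrete time process: `Z_t = Y_{N_{nt}}` for `t < 1`, and
`Z_1 = Z_{1-}`, where `N` is a Poisson process. -/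
noncomputable def markovEmbedding {E : Type*} [TopologicalSpace E] {r : ℝ≥0} {N : ℝ≥0 → Ω → ℕ}
    {P : Measure Ω} (hN : IsPoissonProcess r N P) (Y : ℕ → Ω → E) (n : ℕ) (ω : Ω) :
    SkorokhodSpace E :=
  SkorokhodSpace.subordinate (fun k => Y k ω) (fun t => N (n * t) ω)
    (fun _ _ h => hN.monotone ω (mul_le_mul_right h _))
    (fun t => (hN.right_continuous ω (n * t)).tendsto.comp <| tendsto_nhdsWithin_iff.2
      ⟨((continuous_const_mul (n : ℝ≥0)).tendsto t).mono_left nhdsWithin_le_nhds,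
        eventually_mem_nhdsWithin.mono fun s (h : t ≤ s) => show (n : ℝ≥0) * t ≤ n * s from mul_le_mul_right h _⟩)

/-- The left limit `N_{t-}` of a counting process at time `t`. -/
noncomputable def countBefore (N : ℝ≥0 → Ω → ℕ) (t : ℝ≥0) (ω : Ω) : ℕ :=
  Function.leftLim (fun s => N s ω) t

/-- The oscillation `sup_{k < |n-1-N_{n-}|} |Y_{m+k} - Y_m|` of the chain over the extra steps after
the index `m = (n-1) ∧ N_{n-}`; a supremum over the empty set is `0`. -/
noncomputable def extraSteps {E : Type*} [SeminormedAddCommGroup E] (Y : ℕ → Ω → E)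
    (N : ℝ≥0 → Ω → ℕ) (n : ℕ) (ω : Ω) : ℝ≥0 :=
  (Finset.range ((n : ℤ) - 1 - (countBefore N n ω : ℤ)).natAbs).sup fun k =>
    ‖Y (min (n - 1) (countBefore N n ω) + k) ω - Y (min (n - 1) (countBefore N n ω)) ω‖₊

end Processes

/-! Both embeddings run through the same sequence `Y n`, one along the clock `⌊nt⌋`, the other along
`N (n * t)`. By the weak law of large numbers, uniform in time, the Poisson clock reaches level `i`
at a time close to `i / n`. A piecewise linear time change matching these hitting times for all
levels up to `m = min (n - 1) (N n)` makes the two paths agree until level `m`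
(`edist_subordinate_le`). Afterwards one clock stays at `m` while the other visits the indices up to
`M = max (n - 1) (N n)`, so the `J₁` distance is at most the maximum of a small time shift and the
oscillation of the chain between `m` and `M`. Almost surely `N` does not jump at time `n`, so `N n`
may replace its left limit.

The assumption controls this oscillation at every index except `M` itself, and the missing index is
the crux. There are two cases.

If `N n ≥ n`, then `M = N n`. Since `N` is independent of the chain and the weights of the Poisson
law at `l` and `l + 1` are comparable for `l ≤ 2 * n`, the event that the chain oscillates up to
index `l` while `N n = l` costs at most three times the same event with `N n = l + 1`; in the latter
the index `l` is covered by the assumption (`measure_overshoot_le`).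

If `N n < n - 1`, then `M = n - 1`, and the step from `Y (n - 2)` to `Y (n - 1)` has to be small.
This comes from the convergence in distribution of either embedding: elements of `D[0,1]` are left
continuous at `1`, so the oscillation near `1` is small in probability along a convergent sequence
(`exists_measure_endOscillation_le`). The step embedding always makes this step near time `1`. The
Markov embedding makes it there when `N n ≥ n` and the clock stays near its mean; `N n ≥ n` has
probability at least `1 / 2` and is independent of the chain
(`tendsto_lastStep_of_markovEmbedding`).

Hence convergence of either embedding forces the distance between the two to vanish in probability,
and the limit carries over (`tendstoInDistribution_of_edist`). -/

section TimeChange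

/-! ### Piecewise linear time changes of the unit interval -/

/-- Telescoping for an argument in the `j`-th cell: the cells to its left contribute their full
increment, those to its right nothing. -/
theorem sum_range_increments_mul {r j : ℕ} (hj : j ≤ r) (t c : ℕ → ℝ)
    (h1 : ∀ i < j, c i = 1) (h0 : ∀ i, j < i → i ≤ r → c i = 0) :
    ∑ i ∈ Finset.range (r + 1), (t (i + 1) - t i) * c i
      = t j - t 0 + (t (j + 1) - t j) * c j := by
  have hsub : Finset.range (j + 1) ⊆ Finset.range (r + 1) :=
    Finset.range_subset_range.2 (by omega)
  rw [← Finset.sum_subset hsub, Finset.sum_range_succ, ← Finset.sum_range_sub]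
  · congr 1
    refine Finset.sum_congr rfl fun i hi => ?_
    rw [h1 i (Finset.mem_range.1 hi), mul_one]
  · intro i hi hi'
    rw [Finset.mem_range] at hi hi'
    rw [h0 i (by omega) (by omega), mul_zero]

theorem exists_mem_Icc_consecutive (r : ℕ) (s : ℕ → ℝ) {x : ℝ} (h0 : s 0 ≤ x)
    (h1 : x ≤ s (r + 1)) : ∃ j ≤ r, s j ≤ x ∧ x ≤ s (j + 1) := by
  induction r with
  | zero => exact ⟨0, le_rfl, h0, h1⟩
  | succ r ih =>
    rcases le_total x (s (r + 1)) with h | h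
    · obtain ⟨j, hj, h2⟩ := ih h
      exact ⟨j, by omega, h2⟩
    · exact ⟨r + 1, le_rfl, h, h1⟩

/-- The piecewise linear function with increments `t (i + 1) - t i` over `[s i, s (i + 1)]`. -/
noncomputable def piecewiseLinear (r : ℕ) (s t : ℕ → ℝ) (x : ℝ) : ℝ :=
  ∑ i ∈ Finset.range (r + 1), (t (i + 1) - t i) * max 0 (min 1 ((x - s i) / (s (i + 1) - s i)))

theorem continuous_piecewiseLinear (r : ℕ) (s t : ℕ → ℝ) : Continuous (piecewiseLinear r s t) := by
  unfold piecewiseLinear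
  fun_prop

theorem le_of_consecutive_lt {r : ℕ} {s : ℕ → ℝ} (hs : ∀ i ≤ r, s i < s (i + 1)) {i j : ℕ}
    (hij : i ≤ j) (hj : j ≤ r + 1) : s i ≤ s j := by
  induction j, hij using Nat.le_induction with
  | base => exact le_rfl
  | succ j h ih => exact (ih (by omega)).trans (hs j (by omega)).le

theorem piecewiseLinear_eq {r j : ℕ} (hj : j ≤ r) {s t : ℕ → ℝ} (hs : ∀ i ≤ r, s i < s (i + 1))
    {x : ℝ} (h1 : s j ≤ x) (h2 : x ≤ s (j + 1)) :
    piecewiseLinear r s t x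
      = t j - t 0 + (t (j + 1) - t j) * ((x - s j) / (s (j + 1) - s j)) := by
  have hpos : ∀ i ≤ r, 0 < s (i + 1) - s i := fun i hi => sub_pos.2 (hs i hi)
  rw [piecewiseLinear, sum_range_increments_mul hj t]
  · congr 2
    rw [min_eq_right ((div_le_one (hpos j hj)).2 (by linarith)),
      max_eq_right (div_nonneg (by linarith) (hpos j hj).le)]
  · intro i hi
    have := le_of_consecutive_lt hs (show i + 1 ≤ j by omega) (by omega)
    rw [min_eq_left ((one_le_div (hpos i (by omega))).2 (by linarith))]
    simp
  · intro i hi hir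
    have := le_of_consecutive_lt hs (show j + 1 ≤ i by omega) (by omega)
    exact max_eq_left ((min_le_right _ _).trans
      (div_nonpos_of_nonpos_of_nonneg (by linarith) (hpos i hir).le))

theorem piecewiseLinear_monotone {r : ℕ} {s t : ℕ → ℝ} (hs : ∀ i ≤ r, s i < s (i + 1))
    (ht : ∀ i ≤ r, t i < t (i + 1)) : Monotone (piecewiseLinear r s t) := by
  intro x y hxy
  refine Finset.sum_le_sum fun i hi => ?_
  rw [Finset.mem_range] at hi
  have h1 : 0 < s (i + 1) - s i := sub_pos.2 (hs i (by omega))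
  have h2 : 0 ≤ t (i + 1) - t i := (sub_pos.2 (ht i (by omega))).le
  gcongr

theorem piecewiseLinear_node {r : ℕ} {s t : ℕ → ℝ} (hs : ∀ i ≤ r, s i < s (i + 1)) {i : ℕ}
    (hi : i ≤ r + 1) : piecewiseLinear r s t (s i) = t i - t 0 := by
  rcases Nat.lt_or_ge r i with h | h
  · obtain rfl : i = r + 1 := by omega
    have := sub_pos.2 (hs r le_rfl)
    rw [piecewiseLinear_eq le_rfl hs (hs r le_rfl).le le_rfl, div_self this.ne']
    ring
  · rw [piecewiseLinear_eq h hs le_rfl (hs i h).le]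
    simp

theorem piecewiseLinear_strictMonoOn {r : ℕ} {s t : ℕ → ℝ} (hs : ∀ i ≤ r, s i < s (i + 1))
    (ht : ∀ i ≤ r, t i < t (i + 1)) :
    StrictMonoOn (piecewiseLinear r s t) (Icc (s 0) (s (r + 1))) := by
  intro x hx y hy hxy
  obtain ⟨j, hj, h1, h2⟩ := exists_mem_Icc_consecutive r s hy.1 hy.2
  have hp := sub_pos.2 (hs j hj)
  have hq := sub_pos.2 (ht j hj)
  rw [piecewiseLinear_eq hj hs h1 h2]
  rcases lt_or_ge x (s j) with h | h
  · obtain ⟨i, hi, h3, h4⟩ := exists_mem_Icc_consecutive r s hx.1 hx.2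
    -- If `y` lies strictly inside its cell, strictness is gained between `s j` and `y`. If `y = s
    -- j`, it has to be gained in the cell of `x`, or in the next one when `x` is the right end of
    -- its cell.
    rcases eq_or_lt_of_le h1 with h5 | h5
    · have hij : i < j := by
        by_contra! hc
        have := le_of_consecutive_lt hs hc (by omega)
        linarith
      have hp' := sub_pos.2 (hs i hi)
      have hq' := sub_pos.2 (ht i hi)
      rw [piecewiseLinear_eq hi hs h3 h4]
      have h6 := le_of_consecutive_lt ht (show i + 1 ≤ j by omega) (by omega)
      rw [← h5, sub_self, zero_div, mul_zero, add_zero]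
      rcases eq_or_lt_of_le h4 with h7 | h7
      · have hij' : i + 1 < j := by
          rcases Nat.lt_or_ge (i + 1) j with h8 | h8
          · exact h8
          · have : i + 1 = j := by omega
            rw [this] at h7
            linarith
        have h8 := ht (i + 1) (by omega)
        have h9 := le_of_consecutive_lt ht (show i + 1 + 1 ≤ j by omega) (by omega)
        rw [h7, div_self hp'.ne']
        linarith
      · have : (x - s i) / (s (i + 1) - s i) < 1 := (div_lt_one hp').2 (by linarith)
        nlinarith
    · have h6 := piecewiseLinear_monotone hs ht h.le
      rw [piecewiseLinear_node hs (by omega)] at h6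
      have : 0 < (y - s j) / (s (j + 1) - s j) := div_pos (by linarith) hp
      nlinarith [mul_pos hq this]
  · rw [piecewiseLinear_eq hj hs h (hxy.le.trans h2)]
    gcongr

/-- Within a cell the displacement is a convex combination of the displacements at the two end
nodes. -/
theorem abs_piecewiseLinear_sub_le {r : ℕ} {s t : ℕ → ℝ} (hs : ∀ i ≤ r, s i < s (i + 1))
    (ht0 : t 0 = 0) {D : ℝ} (hD : ∀ i ≤ r + 1, |t i - s i| ≤ D) {x : ℝ}
    (hx : x ∈ Icc (s 0) (s (r + 1))) : |piecewiseLinear r s t x - x| ≤ D := by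
  obtain ⟨j, hj, h1, h2⟩ := exists_mem_Icc_consecutive r s hx.1 hx.2
  have hp := sub_pos.2 (hs j hj)
  rw [piecewiseLinear_eq hj hs h1 h2, ht0]
  set θ := (x - s j) / (s (j + 1) - s j) with hθ
  have hx' : x = s j + (s (j + 1) - s j) * θ := by rw [hθ]; field_simp; ring
  have hθ0 : 0 ≤ θ := div_nonneg (by linarith) hp.le
  have hθ1 : θ ≤ 1 := (div_le_one hp).2 (by linarith)
  have e : t j - 0 + (t (j + 1) - t j) * θ - x
      = (1 - θ) * (t j - s j) + θ * (t (j + 1) - s (j + 1)) := by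
    rw [hx']; ring
  have ha := abs_le.1 (hD j (by omega))
  have hb := abs_le.1 (hD (j + 1) (by omega))
  rw [e, abs_le]
  constructor <;> nlinarith

/-- A time change of `[0,1]` that carries the nodes `s i` to the nodes `t i`. -/
theorem exists_timeChange {r : ℕ} {s t : ℕ → ℝ} (hs : ∀ i ≤ r, s i < s (i + 1))
    (ht : ∀ i ≤ r, t i < t (i + 1)) (hs0 : s 0 = 0) (ht0 : t 0 = 0) (hs1 : s (r + 1) = 1)
    (ht1 : t (r + 1) = 1) {D : ℝ} (hD : ∀ i ≤ r + 1, |t i - s i| ≤ D) :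
    ∃ e : I ≃o I, (∀ x : I, |(e x : ℝ) - x| ≤ D) ∧
      ∀ x : I, ∀ i ≤ r + 1, s i ≤ x ↔ t i ≤ e x := by
  have hI : Icc (s 0) (s (r + 1)) = I := by rw [hs0, hs1]
  have hF0 : piecewiseLinear r s t 0 = 0 := by
    have := piecewiseLinear_node (t := t) hs (Nat.zero_le (r + 1))
    rwa [hs0, sub_self] at this
  have hF1 : piecewiseLinear r s t 1 = 1 := by
    have := piecewiseLinear_node (t := t) hs (le_refl (r + 1))
    rwa [hs1, ht1, ht0, sub_zero] at this
  have hmono := piecewiseLinear_monotone hs ht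
  have hmem : ∀ x : I, piecewiseLinear r s t x ∈ I := fun x =>
    ⟨hF0 ▸ hmono x.2.1, hF1 ▸ hmono x.2.2⟩
  have hstrict := hI ▸ piecewiseLinear_strictMonoOn hs ht
  let F : I → I := fun x => ⟨piecewiseLinear r s t x, hmem x⟩
  have hF : StrictMono F := fun x y hxy => hstrict x.2 y.2 hxy
  have hsurj : Function.Surjective F := by
    intro z
    have h := intermediate_value_Icc zero_le_one (continuous_piecewiseLinear r s t).continuousOn
    rw [hF0, hF1] at h
    obtain ⟨x, hx, hxz⟩ := h z.2
    exact ⟨⟨x, hx⟩, Subtype.ext hxz⟩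
  refine ⟨hF.orderIsoOfSurjective F hsurj, fun x => ?_, fun x i hi => ?_⟩
  · exact abs_piecewiseLinear_sub_le hs ht0 hD (by rw [hI]; exact x.2)
  · have hsi : s i ∈ I := hI.subset ⟨le_of_consecutive_lt hs (Nat.zero_le i) hi,
      le_of_consecutive_lt hs hi le_rfl⟩
    rw [← hstrict.le_iff_le hsi x.2, piecewiseLinear_node hs hi, ht0, sub_zero]
    rfl

end TimeChange

/-! ### Comparing two step paths along the same sequence -/

namespace SkorokhodSpace

section Comparison

variable {E : Type*}

theorem subordinate_apply [TopologicalSpace E] (y : ℕ → E) (c : ℝ≥0 → ℕ) (hm : Monotone c)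
    (hc : ∀ t, ContinuousWithinAt c (Ici t) t) {t : I} (ht : t < 1) :
    subordinate y c hm hc t = y (c (unitInterval.toNNReal t)) :=
  if_pos ht

variable [PseudoEMetricSpace E]

/-- An increasing time change fixes `1`, so left continuity of both paths carries the bound over to
`1`. Thus only times `t < 1`, where a subordinated path is given by its clock, need to be examined.
-/
theorem edist_apply_one_le (f g : SkorokhodSpace E) (e : I ≃o I) {C : ℝ≥0∞}
    (h : ∀ t < 1, edist (f (e t)) (g t) ≤ C) : edist (f (e 1)) (g 1) ≤ C := by
  have he : e 1 = 1 := e.map_top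
  have h1 : Tendsto e (𝓝[<] 1) (𝓝[<] 1) := by
    refine tendsto_nhdsWithin_iff.2 ⟨?_, eventually_mem_nhdsWithin.mono fun s hs => ?_⟩
    · have := (e.continuous.tendsto 1).mono_left (nhdsWithin_le_nhds (s := Iio (1 : I)))
      rwa [he] at this
    · have := e.strictMono hs
      rwa [he] at this
  have hne : (𝓝[<] (1 : I)).NeBot := nhdsLT_neBot_of_exists_lt ⟨0, zero_lt_one⟩
  rw [he]
  refine le_of_tendsto ((f.left_continuous_one.comp h1).edist g.left_continuous_one) ?_
  exact eventually_mem_nhdsWithin.mono fun t ht => h t ht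

theorem edist_le_of_orderIso (f g : SkorokhodSpace E) (e : I ≃o I) {C : ℝ≥0∞} {D : ℝ}
    (h : ∀ t < 1, edist (f (e t)) (g t) ≤ C) (hD : ∀ t, |(e t : ℝ) - t| ≤ D) :
    edist f g ≤ max C (ENNReal.ofReal D) := by
  refine (iInf_le _ e.toHomeomorph).trans (sup_le_sup (iSup_le fun t => ?_) (iSup_le fun t => ?_))
  · rcases lt_or_eq_of_le (unitInterval.le_one' (t := t)) with ht | rfl
    · exact h t ht
    · exact edist_apply_one_le f g e h
  · rw [edist_dist]
    exact ENNReal.ofReal_le_ofReal (hD t)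

/-- Two step paths along the same sequence `y` are close if their clocks reach the first levels at
nearby times and `y` does not oscillate over the values visited afterwards. -/
theorem edist_subordinate_le (y : ℕ → E) {c c' : ℝ≥0 → ℕ} (hm : Monotone c)
    (hc : ∀ t, ContinuousWithinAt c (Ici t) t) (hm' : Monotone c')
    (hc' : ∀ t, ContinuousWithinAt c' (Ici t) t) {r : ℕ} {s t : ℕ → ℝ}
    (hs : ∀ i < r, s i < s (i + 1)) (ht : ∀ i < r, t i < t (i + 1)) (hs0 : s 0 = 0)
    (ht0 : t 0 = 0) (hs1 : s r < 1) (ht1 : t r < 1)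
    (hcs : ∀ u < 1, ∀ i ≤ r, i ≤ c u ↔ s i ≤ u) (hct : ∀ u < 1, ∀ i ≤ r, i ≤ c' u ↔ t i ≤ u)
    {D : ℝ} (hD : ∀ i ≤ r, |s i - t i| ≤ D) {C : ℝ≥0∞}
    (hC : ∀ u < 1, ∀ v < 1, r ≤ c u → r ≤ c' v → edist (y (c u)) (y (c' v)) ≤ C) :
    edist (subordinate y c hm hc) (subordinate y c' hm' hc') ≤ max C (ENNReal.ofReal D) := by
  -- The point `1` is appended as a last node on both sides, so that the nodes subdivide all of
  -- `[0,1]`.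
  let s' : ℕ → ℝ := fun i => if i ≤ r then s i else 1
  let t' : ℕ → ℝ := fun i => if i ≤ r then t i else 1
  have hs' : ∀ i ≤ r, s' i = s i := fun i hi => if_pos hi
  have ht' : ∀ i ≤ r, t' i = t i := fun i hi => if_pos hi
  have hs1' : s' (r + 1) = 1 := if_neg (by omega)
  have ht1' : t' (r + 1) = 1 := if_neg (by omega)
  have hD0 : 0 ≤ D := (abs_nonneg _).trans (hD 0 (Nat.zero_le r))
  have mono : ∀ {a a' : ℕ → ℝ}, (∀ i < r, a i < a (i + 1)) → a r < 1 → (∀ i ≤ r, a' i = a i) →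
      a' (r + 1) = 1 → ∀ i ≤ r, a' i < a' (i + 1) := by
    intro a a' h h1 h2 h3 i hi
    rcases hi.lt_or_eq with hlt | rfl
    · rw [h2 i hi, h2 (i + 1) hlt]
      exact h i hlt
    · rwa [h3, h2 _ le_rfl]
  obtain ⟨e, he1, he2⟩ := exists_timeChange (D := D) (mono ht ht1 ht' ht1') (mono hs hs1 hs' hs1')
    ((ht' 0 (Nat.zero_le r)).trans ht0) ((hs' 0 (Nat.zero_le r)).trans hs0) ht1' hs1' (by
      intro i hi
      rcases Nat.lt_or_ge r i with h | h
      · obtain rfl : i = r + 1 := by omega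
        simpa [hs1', ht1'] using hD0
      · rw [hs' i h, ht' i h]
        exact hD i h)
  refine edist_le_of_orderIso _ _ e (fun u hu => ?_) he1
  have heu : e u < 1 := lt_of_lt_of_eq (e.strictMono hu) e.map_top
  have hu' : unitInterval.toNNReal u < 1 := hu
  have heu' : unitInterval.toNNReal (e u) < 1 := heu
  rw [subordinate_apply _ _ _ _ heu, subordinate_apply _ _ _ _ hu]
  -- The time change carries `t i` to `s i`, so up to level `r` both clocks have reached the same
  -- levels. Below `r` they therefore coincide; from `r` on, `hC` takes over.
  have key : ∀ i ≤ r, i ≤ c (unitInterval.toNNReal (e u)) ↔ i ≤ c' (unitInterval.toNNReal u) := by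
    intro i hi
    have := he2 u i (by omega)
    rw [hs' i hi, ht' i hi] at this
    rw [hcs _ heu' i hi, hct _ hu' i hi]
    exact this.symm
  rcases Nat.lt_or_ge (c' (unitInterval.toNNReal u)) r with h | h
  · have h1 := (key _ h.le).2 le_rfl
    have h2 := mt (key _ h).1 (by omega)
    rw [show c (unitInterval.toNNReal (e u)) = c' (unitInterval.toNNReal u) by omega, edist_self]
    exact zero_le
  · exact hC _ heu' _ hu' ((key r le_rfl).2 h) h

end Comparison

end SkorokhodSpace

theorem tendsto_const_div_succ_atTop_nhds_zero (a : ℝ) :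
    Tendsto (fun k : ℕ => a / ((k : ℝ) + 1)) atTop (𝓝 0) := by
  have h := (tendsto_add_atTop_iff_nat 1).2 (tendsto_const_div_atTop_nhds_zero_nat a)
  simpa using h

/-! ### Estimates for the Poisson distribution -/

section Poisson

theorem poissonMeasure_one_le (h : ℝ≥0) :
    poissonMeasure h {k | 1 ≤ k} ≤ ENNReal.ofReal h := by
  have e : {k : ℕ | 1 ≤ k} = {0}ᶜ := by
    ext k
    simp [Nat.one_le_iff_ne_zero]
  rw [e, prob_compl_eq_one_sub (measurableSet_singleton 0), poissonMeasure_singleton,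
    ← ENNReal.ofReal_one, ← ENNReal.ofReal_sub _ (by positivity)]
  refine ENNReal.ofReal_le_ofReal ?_
  have := Real.add_one_le_exp (-(h : ℝ))
  simp
  linarith

/-- From `exp (-h) ≥ 1 - h` one gets `1 - exp (-h) * (1 + h) ≤ h ^ 2`. The quadratic order beats the
number of cells of a mesh of size `h`, which excludes double jumps. -/
theorem poissonMeasure_two_le (h : ℝ≥0) :
    poissonMeasure h {k | 2 ≤ k} ≤ ENNReal.ofReal (h ^ 2) := by
  have e : {k : ℕ | 2 ≤ k} = ({0} ∪ {1})ᶜ := by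
    ext k
    simp
    omega
  rw [e, prob_compl_eq_one_sub ((measurableSet_singleton 0).union (measurableSet_singleton 1)),
    measure_union (by simp) (measurableSet_singleton 1), poissonMeasure_singleton,
    poissonMeasure_singleton, ← ENNReal.ofReal_one, ← ENNReal.ofReal_add (by positivity)
    (by positivity), ← ENNReal.ofReal_sub _ (by positivity)]
  refine ENNReal.ofReal_le_ofReal ?_
  have h1 := Real.add_one_le_exp (-(h : ℝ))
  have h2 : (0 : ℝ) ≤ h := h.2
  simp
  nlinarith

/-- The recursion `p (n + 1) * (n + 1) = l * p n` yields the first two factorial moments, and `(n -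
l) ^ 2 = n * (n - 1) + (1 - 2 * l) * n + l ^ 2`. -/
theorem hasSum_poisson_variance (l : ℝ≥0) :
    HasSum (fun n : ℕ => Real.exp (-l) * l ^ n / n.factorial * ((n : ℝ) - l) ^ 2) l := by
  set p : ℕ → ℝ := fun n => Real.exp (-l) * l ^ n / n.factorial with hp
  have h0 : HasSum p 1 := hasSum_one_poissonMeasure l
  have hrec : ∀ n, p (n + 1) * (n + 1) = l * p n := by
    intro n
    simp only [hp, Nat.factorial_succ, pow_succ]
    push_cast
    field_simp
  have h1 : HasSum (fun n : ℕ => p n * n) l := by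
    rw [← hasSum_nat_add_iff' 1]
    simpa [hrec] using h0.mul_left (l : ℝ)
  have h2 : HasSum (fun n : ℕ => p n * (n * (n - 1))) ((l : ℝ) * l) := by
    rw [← hasSum_nat_add_iff' 1]
    have : (fun n : ℕ => p (n + 1) * (((n + 1 : ℕ) : ℝ) * (((n + 1 : ℕ) : ℝ) - 1)))
        = fun n => l * (p n * n) := by
      funext n
      push_cast
      rw [← mul_assoc, ← mul_assoc, hrec]
      ring
    rw [this]
    simpa using h1.mul_left (l : ℝ)
  convert (h2.add (h1.mul_left (1 - 2 * (l : ℝ)))).add (h0.mul_left ((l : ℝ) ^ 2)) using 1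
  · funext n
    ring
  · ring

theorem poissonMeasure_abs_sub_ge_le (l : ℝ≥0) {a : ℝ} (ha : 0 < a) :
    poissonMeasure l {k | a ≤ |(k : ℝ) - l|} ≤ ENNReal.ofReal (l / a ^ 2) := by
  have hint : Integrable (fun k : ℕ => ((k : ℝ) - l) ^ 2) (poissonMeasure l) := by
    rw [integrable_poissonMeasure_iff]
    simpa using (hasSum_poisson_variance l).summable
  have hval : ∫ k : ℕ, ((k : ℝ) - l) ^ 2 ∂(poissonMeasure l) = l := by
    rw [integral_poissonMeasure]
    exact (hasSum_poisson_variance l).tsum_eq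
  have hm := mul_meas_ge_le_integral_of_nonneg (ae_of_all _ fun k : ℕ => sq_nonneg ((k : ℝ) - l))
    hint (a ^ 2)
  rw [hval] at hm
  have hset : {k : ℕ | a ≤ |(k : ℝ) - l|} ⊆ {k : ℕ | a ^ 2 ≤ ((k : ℝ) - l) ^ 2} := fun k hk => by
    rw [mem_ofPred_eq, ← sq_abs ((k : ℝ) - l)]
    exact pow_le_pow_left₀ ha.le hk 2
  refine (measure_mono hset).trans ?_
  rw [ENNReal.le_ofReal_iff_toReal_le (measure_ne_top _ _) (by positivity),
    le_div_iff₀ (by positivity), mul_comm]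
  exact hm

theorem poissonMeasure_singleton_succ (l : ℝ≥0) (n : ℕ) :
    (poissonMeasure l).real {n + 1} * (n + 1) = l * (poissonMeasure l).real {n} := by
  rw [poissonMeasure_real_singleton, poissonMeasure_real_singleton, Nat.factorial_succ, pow_succ]
  push_cast
  field_simp

/-- Induction outwards from the equal weights at `n - 1` and `n`. A further step multiplies the left
weight by `(n - (j + 1)) / n` and the right one by `n / (n + (j + 1))`; the first factor is the
smaller, since `(n - (j + 1)) * (n + (j + 1)) ≤ n ^ 2`. -/
theorem poissonMeasure_reflect_le (n j : ℕ) (hj : j < n) :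
    (poissonMeasure n).real {n - 1 - j} ≤ (poissonMeasure n).real {n + j} := by
  have hn : (0 : ℝ) < n := by exact_mod_cast (show 0 < n by omega)
  induction j with
  | zero =>
    have h := poissonMeasure_singleton_succ n (n - 1)
    obtain ⟨m, rfl⟩ : ∃ m, n = m + 1 := ⟨n - 1, by omega⟩
    simp only [Nat.add_sub_cancel, Nat.sub_zero, Nat.add_zero] at h ⊢
    push_cast at h ⊢
    refine (mul_left_cancel₀ (show (m : ℝ) + 1 ≠ 0 by positivity) ?_).le
    linarith
  | succ j ih =>
    have h1 := ih (by omega)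
    have h2 := poissonMeasure_singleton_succ n (n + j)
    have h3 := poissonMeasure_singleton_succ n (n - 1 - (j + 1))
    rw [show n - 1 - (j + 1) + 1 = n - 1 - j by omega] at h3
    have h4 : ((n - 1 - (j + 1) : ℕ) : ℝ) = n - 1 - (j + 1) := by
      rw [show n - 1 - (j + 1) = n - (j + 2) by omega, Nat.cast_sub (by omega)]
      push_cast
      ring
    rw [h4] at h3
    rw [← add_assoc]
    set a := (poissonMeasure n).real {n - 1 - (j + 1)}
    set b := (poissonMeasure n).real {n - 1 - j}
    set c := (poissonMeasure n).real {n + j}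
    set d := (poissonMeasure n).real {n + j + 1}
    have hc : 0 ≤ c := measureReal_nonneg
    have hb : 0 ≤ b := measureReal_nonneg
    have hjn : (j : ℝ) + 1 < n := by exact_mod_cast hj
    have e3 : b * (n - (j + 1)) = n * a := by
      rw [← NNReal.coe_natCast n, ← h3]
      push_cast
      ring
    have e2 : d * (n + (j + 1)) = n * c := by
      rw [← NNReal.coe_natCast n, ← h2]
      push_cast
      ring
    have hj0 : (0 : ℝ) ≤ j := j.cast_nonneg
    have key : n * (a * (n + (j + 1))) ≤ n * (d * (n + (j + 1))) := by
      rw [e2, ← mul_assoc, ← e3]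
      have : (n - (j + 1) : ℝ) * (n + (j + 1)) ≤ n * n := by nlinarith
      nlinarith [mul_nonneg hb hj0]
    exact le_of_mul_le_mul_right (le_of_mul_le_mul_left key hn) (by positivity)

/-- The reflection `n - 1 - j ↦ n + j` maps `{k | k < n}` injectively into `{k | n ≤ k}` without
decreasing any weight. -/
theorem half_le_poissonMeasure_ge (n : ℕ) :
    1 / 2 ≤ (poissonMeasure n).real {k | n ≤ k} := by
  have h1 : (poissonMeasure n).real {k | k < n} ≤ (poissonMeasure n).real {k | n ≤ k} := by
    have e1 : {k : ℕ | k < n} = (Finset.range n : Set ℕ) := by ext; simp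
    have e2 : (((Finset.range n).map (addLeftEmbedding n) : Finset ℕ) : Set ℕ) ⊆ {k | n ≤ k} := by
      intro k
      simp
      omega
    refine le_trans ?_ (measureReal_mono e2)
    rw [e1, ← sum_measureReal_singleton, ← sum_measureReal_singleton, Finset.sum_map,
      ← Finset.sum_range_reflect]
    refine Finset.sum_le_sum fun j hj => ?_
    exact poissonMeasure_reflect_le n j (Finset.mem_range.1 hj)
  have h2 := probReal_compl_eq_one_sub (μ := poissonMeasure (n : ℝ≥0))
    (s := {k | n ≤ k}) (MeasurableSet.of_discrete)
  rw [show {k : ℕ | n ≤ k}ᶜ = {k | k < n} by ext; simp] at h2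
  linarith

end Poisson

/-! ### Path properties and the law of large numbers for the Poisson process -/

namespace IsPoissonProcess

variable {Ω : Type*} [MeasurableSpace Ω] {P : Measure Ω} {N : ℝ≥0 → Ω → ℕ}

theorem measure_increment (hN : IsPoissonProcess 1 N P) {s t : ℝ≥0} (hst : s ≤ t) (A : Set ℕ) :
    P {ω | N t ω - N s ω ∈ A} = poissonMeasure (t - s) A := by
  have h := hN.law_increment s t hst
  rw [one_mul] at h
  have hmeas : Measurable fun ω => N t ω - N s ω := (hN.measurable t).sub (hN.measurable s)
  rw [← h, Measure.map_apply hmeas MeasurableSet.of_discrete]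
  rfl

theorem measure_count (hN : IsPoissonProcess 1 N P) (t : ℝ≥0) (A : Set ℕ) :
    P {ω | N t ω ∈ A} = poissonMeasure t A := by
  simpa [hN.zero] using hN.measure_increment (zero_le (a := t)) A

/-- No jump at a fixed time: a jump at `t` makes the increment over each interval `(t - t / (k + 1),
t]` positive, which has probability at most `t / (k + 1)`. -/
theorem ae_exists_lt_eq (hN : IsPoissonProcess 1 N P) {t : ℝ≥0} (ht : 0 < t) :
    ∀ᵐ ω ∂P, ∃ v < t, N v ω = N t ω := by
  rw [ae_iff]
  refine le_antisymm (ge_of_tendsto' (f := fun k : ℕ => ENNReal.ofReal (t / ((k : ℝ) + 1)))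
    (x := atTop) ?_ fun k => ?_) zero_le
  · rw [← ENNReal.ofReal_zero]
    exact ENNReal.tendsto_ofReal (tendsto_const_div_succ_atTop_nhds_zero t)
  · have hlt : 0 < t / (k + 1) := by positivity
    have hle : t / (k + 1) ≤ t := div_le_self zero_le (by simp)
    have hsub : t - t / (k + 1) < t := tsub_lt_self ht hlt
    have := hN.measure_increment hsub.le {k | 1 ≤ k}
    rw [tsub_tsub_cancel_of_le hle] at this
    refine le_trans (measure_mono fun ω hω => ?_)
      ((this.trans_le (poissonMeasure_one_le _)).trans_eq (by simp))
    simp only [mem_ofPred_eq, not_exists, not_and] at hω ⊢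
    have h1 := hω _ hsub
    have h2 : N (t - t / (k + 1)) ω ≤ N t ω := hN.monotone ω hsub.le
    omega

/-- A jump of size at least two forces an increment of at least two over some cell of the mesh `1 /
(m + 1)`. There are `A * (m + 1)` cells, each with probability at most `(1 / (m + 1)) ^ 2`. -/
theorem measure_doubleJump_le (hN : IsPoissonProcess 1 N P) (A m : ℕ) :
    P {ω | ∃ u : ℝ≥0, 0 < u ∧ u ≤ A ∧ ∀ v < u, N v ω + 2 ≤ N u ω}
      ≤ ENNReal.ofReal (A / ((m : ℝ) + 1)) := by
  have hm : (0 : ℝ≥0) < m + 1 := by positivity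
  have hsub : {ω | ∃ u : ℝ≥0, 0 < u ∧ u ≤ A ∧ ∀ v < u, N v ω + 2 ≤ N u ω} ⊆
      ⋃ k ∈ Finset.range (A * (m + 1)),
        {ω | N (((k + 1 : ℕ) : ℝ≥0) / (m + 1)) ω - N ((k : ℝ≥0) / (m + 1)) ω ∈ {k | 2 ≤ k}} := by
    rintro ω ⟨u, hu0, huA, hu⟩
    have hpos : 0 < u * (m + 1) := by positivity
    have hc : 0 < ⌈u * (m + 1)⌉₊ := Nat.ceil_pos.2 hpos
    set k := ⌈u * (m + 1)⌉₊ - 1 with hk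
    have hk1 : k + 1 = ⌈u * (m + 1)⌉₊ := by omega
    simp only [mem_iUnion, Finset.mem_range, exists_prop, mem_ofPred_eq]
    refine ⟨k, ?_, ?_⟩
    · have : ⌈u * (m + 1)⌉₊ ≤ A * (m + 1) := by
        rw [Nat.ceil_le]
        push_cast
        gcongr
      omega
    · have h1 : (k : ℝ≥0) / (m + 1) < u := by
        rw [div_lt_iff₀ hm, ← Nat.lt_ceil]
        omega
      have h2 : u ≤ ((k + 1 : ℕ) : ℝ≥0) / (m + 1) := by
        rw [le_div_iff₀ hm, hk1]
        exact Nat.le_ceil _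
      have h3 := hu _ h1
      have h4 : N u ω ≤ _ := hN.monotone ω h2
      simp only at h4
      omega
  refine (measure_mono hsub).trans ((measure_biUnion_finset_le _ _).trans ?_)
  have hterm : ∀ k ∈ Finset.range (A * (m + 1)),
      P {ω | N (((k + 1 : ℕ) : ℝ≥0) / (m + 1)) ω - N ((k : ℝ≥0) / (m + 1)) ω ∈ {k | 2 ≤ k}}
        ≤ ENNReal.ofReal ((1 / ((m : ℝ) + 1)) ^ 2) := by
    intro k _
    rw [hN.measure_increment (by gcongr; omega)]
    refine (poissonMeasure_two_le _).trans_eq ?_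
    congr 2
    rw [← NNReal.sub_div]
    push_cast
    rw [add_tsub_cancel_left]
    norm_num
  refine (Finset.sum_le_sum hterm).trans ?_
  rw [Finset.sum_const, Finset.card_range, nsmul_eq_mul, ← ENNReal.ofReal_natCast,
    ← ENNReal.ofReal_mul (by positivity)]
  refine ENNReal.ofReal_le_ofReal (le_of_eq ?_)
  push_cast
  field_simp

/-- Almost surely, all jumps of a Poisson process have size one. -/
theorem ae_simple (hN : IsPoissonProcess 1 N P) :
    ∀ᵐ ω ∂P, ∀ u > 0, ∃ v < u, N u ω ≤ N v ω + 1 := by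
  have h : ∀ A : ℕ, ∀ᵐ ω ∂P, ¬ ∃ u : ℝ≥0, 0 < u ∧ u ≤ A ∧ ∀ v < u, N v ω + 2 ≤ N u ω := by
    intro A
    rw [ae_iff]
    simp only [not_not]
    refine le_antisymm (ge_of_tendsto' (f := fun m : ℕ => ENNReal.ofReal (A / ((m : ℝ) + 1)))
      (x := atTop) ?_ fun m => hN.measure_doubleJump_le A m) zero_le
    rw [← ENNReal.ofReal_zero]
    exact ENNReal.tendsto_ofReal (tendsto_const_div_succ_atTop_nhds_zero A)
  filter_upwards [ae_all_iff.2 h] with ω hω u hu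
  by_contra! hcon
  obtain ⟨A, hA⟩ := exists_nat_ge u
  exact hω A ⟨u, hu, hA, fun v hv => hcon v hv⟩

/-- The weak law of large numbers for a Poisson process, uniformly in time. -/
theorem tendsto_measure_deviation (hN : IsPoissonProcess 1 N P) {ε : ℝ} (hε : 0 < ε) :
    Tendsto (fun n : ℕ => P {ω | ∃ t : ℝ≥0, t ≤ n ∧ ε * n < |(N t ω : ℝ) - t|}) atTop (𝓝 0) := by
  -- A grid of `K + 1` points, their number independent of `n`, with spacing `n / K` at most `ε / 2
  -- * n`. Each point contributes `O(1 / n)` by Chebyshev's inequality.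
  obtain ⟨K, hK⟩ := exists_nat_gt (2 / ε)
  have hK0 : (0 : ℝ) < K := lt_trans (by positivity) hK
  have hK0' : (0 : ℝ≥0) < K := by exact_mod_cast hK0
  have hKε : 1 / (K : ℝ) ≤ ε / 2 := by
    rw [div_lt_iff₀ hε] at hK
    rw [div_le_div_iff₀ hK0 two_pos]
    linarith
  have hbound : ∀ n : ℕ, 0 < n → P {ω | ∃ t : ℝ≥0, t ≤ n ∧ ε * n < |(N t ω : ℝ) - t|}
      ≤ ENNReal.ofReal ((K + 1) * (4 / ε ^ 2) / n) := by
    intro n hn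
    have hn0 : (0 : ℝ) < n := by exact_mod_cast hn
    have hn0' : (0 : ℝ≥0) < n := by exact_mod_cast hn
    let g : ℕ → ℝ≥0 := fun j => n * (j / K)
    have hsub : {ω | ∃ t : ℝ≥0, t ≤ n ∧ ε * n < |(N t ω : ℝ) - t|} ⊆
        ⋃ j ∈ Finset.range (K + 1),
          {ω | N (g j) ω ∈ {k : ℕ | ε / 2 * n ≤ |(k : ℝ) - g j|}} := by
      rintro ω ⟨t, htn, ht⟩
      by_contra! hcon
      simp only [mem_iUnion, Finset.mem_range, exists_prop, mem_ofPred_eq, not_exists, not_and,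
        not_le] at hcon
      set x : ℝ≥0 := t * K / n with hx
      have hxK : x ≤ K := by
        rw [hx, div_le_iff₀ hn0', mul_comm]
        gcongr
      have htx : (t : ℝ) = n * (x / K) := by
        rw [hx]
        push_cast
        field_simp
      have h1 : ⌊x⌋₊ ≤ K := Nat.floor_le_of_le hxK
      have h2 : ⌈x⌉₊ ≤ K := Nat.ceil_le.2 hxK
      have hfl : ((⌊x⌋₊ : ℕ) : ℝ) ≤ x := by exact_mod_cast Nat.floor_le (zero_le (a := x))
      have hcl : (x : ℝ) ≤ (⌈x⌉₊ : ℕ) := by exact_mod_cast Nat.le_ceil x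
      have hfl' : (x : ℝ) < (⌊x⌋₊ : ℕ) + 1 := by exact_mod_cast Nat.lt_floor_add_one x
      have hcl' : ((⌈x⌉₊ : ℕ) : ℝ) < x + 1 := by
        exact_mod_cast Nat.ceil_lt_add_one (zero_le (a := x))
      have hg : ∀ j, ((g j : ℝ≥0) : ℝ) = n * (j / K) := fun j => by simp [g]
      have g1 : ((g ⌊x⌋₊ : ℝ≥0) : ℝ) ≤ t := by
        rw [hg, htx]
        gcongr
      have g2 : (t : ℝ) ≤ g ⌈x⌉₊ := by
        rw [hg, htx]
        gcongr
      have hstep : (n : ℝ) * (1 / K) ≤ ε / 2 * n := by nlinarith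
      have g3 : (t : ℝ) - ε / 2 * n ≤ g ⌊x⌋₊ := by
        have : (n : ℝ) * (x / K) ≤ n * ((⌊x⌋₊ + 1) / K) := by gcongr
        rw [add_div, mul_add] at this
        rw [hg, htx]
        linarith
      have g4 : ((g ⌈x⌉₊ : ℝ≥0) : ℝ) ≤ t + ε / 2 * n := by
        have : (n : ℝ) * (⌈x⌉₊ / K) ≤ n * ((x + 1) / K) := by gcongr
        rw [add_div, mul_add] at this
        rw [hg, htx]
        linarith
      -- By monotonicity `N t` lies between its values at the neighbouring grid points. These
      -- deviate by less than `ε / 2 * n` from their means, which differ from `t` by at most another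
      -- `ε / 2 * n`.
      have n1 : (N (g ⌊x⌋₊) ω : ℝ) ≤ N t ω := by
        exact_mod_cast hN.monotone ω (show g ⌊x⌋₊ ≤ t from g1)
      have n2 : (N t ω : ℝ) ≤ N (g ⌈x⌉₊) ω := by
        exact_mod_cast hN.monotone ω (show t ≤ g ⌈x⌉₊ from g2)
      have a1 := abs_lt.1 (hcon _ (Nat.lt_succ_of_le h1))
      have a2 := abs_lt.1 (hcon _ (Nat.lt_succ_of_le h2))
      rcases lt_abs.1 ht with h | h <;> linarith
    refine (measure_mono hsub).trans ((measure_biUnion_finset_le _ _).trans ?_)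
    have hterm : ∀ j ∈ Finset.range (K + 1),
        P {ω | N (g j) ω ∈ {k : ℕ | ε / 2 * n ≤ |(k : ℝ) - g j|}}
          ≤ ENNReal.ofReal (4 / ε ^ 2 / n) := by
      intro j hj
      rw [hN.measure_count]
      refine (poissonMeasure_abs_sub_ge_le _ (by positivity)).trans (ENNReal.ofReal_le_ofReal ?_)
      have : ((g j : ℝ≥0) : ℝ) ≤ n := by
        have hjK : (j : ℝ) ≤ K := by exact_mod_cast Nat.lt_succ_iff.1 (Finset.mem_range.1 hj)
        simp only [g, NNReal.coe_mul, NNReal.coe_div, NNReal.coe_natCast]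
        exact mul_le_of_le_one_right hn0.le ((div_le_one hK0).2 hjK)
      calc ((g j : ℝ≥0) : ℝ) / (ε / 2 * n) ^ 2 ≤ n / (ε / 2 * n) ^ 2 := by gcongr
        _ = 4 / ε ^ 2 / n := by field_simp; norm_num
    refine (Finset.sum_le_sum hterm).trans ?_
    rw [Finset.sum_const, Finset.card_range, nsmul_eq_mul, ← ENNReal.ofReal_natCast,
      ← ENNReal.ofReal_mul (by positivity)]
    refine ENNReal.ofReal_le_ofReal (le_of_eq ?_)
    push_cast
    ring
  refine tendsto_of_tendsto_of_tendsto_of_le_of_le' tendsto_const_nhds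
    (h := fun n : ℕ => ENNReal.ofReal ((K + 1) * (4 / ε ^ 2) / n)) ?_
    (Eventually.of_forall fun _ => zero_le) ((eventually_gt_atTop 0).mono hbound)
  rw [← ENNReal.ofReal_zero]
  exact ENNReal.tendsto_ofReal (tendsto_const_div_atTop_nhds_zero_nat _)

end IsPoissonProcess

/-- A nondecreasing right continuous clock with values in `ℕ` that starts at `0`, has jumps of size
one, and does not jump at time `1`. -/
structure IsSimpleClock (c : ℝ≥0 → ℕ) : Prop where
  monotone : Monotone c
  right_continuous : ∀ t, ContinuousWithinAt c (Ici t) t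
  zero : c 0 = 0
  simple : ∀ u > 0, ∃ v < u, c u ≤ c v + 1
  exists_eq_one : ∃ v < 1, c v = c 1

/-- The first time at which the clock `c` reaches `i`. -/
noncomputable def hittingTime (c : ℝ≥0 → ℕ) (i : ℕ) : ℝ≥0 := sInf {u | i ≤ c u}

theorem hittingTime_zero (c : ℝ≥0 → ℕ) : hittingTime c 0 = 0 :=
  le_antisymm (csInf_le' (by simp)) zero_le

/-! ### Hitting times of a clock -/

namespace IsSimpleClock

variable {c : ℝ≥0 → ℕ}

/-- Right continuity makes the infimum a minimum. The assumption `i ≤ c a` keeps the set nonempty;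
the infimum of the empty set would be `0`. -/
theorem le_iff (hc : IsSimpleClock c) {i : ℕ} {a : ℝ≥0} (ha : i ≤ c a) (u : ℝ≥0) :
    i ≤ c u ↔ hittingTime c i ≤ u := by
  refine ⟨fun h => csInf_le' h, fun h => le_trans ?_ (hc.monotone h)⟩
  have h1 : ∀ᶠ v in 𝓝[≥] (hittingTime c i), c v = c (hittingTime c i) :=
    (hc.right_continuous (hittingTime c i)).tendsto.eventually
      (p := fun k => k = c (hittingTime c i)) (by simp)
  obtain ⟨b, hb, hb'⟩ := (mem_nhdsGE_iff_exists_Ico_subset' (lt_add_one (hittingTime c i))).1 h1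
  obtain ⟨v, hv, hvb⟩ := exists_lt_of_csInf_lt ⟨a, ha⟩ hb
  have h2 : c v = c (hittingTime c i) := hb' ⟨csInf_le' hv, hvb⟩
  exact h2 ▸ hv

/-- Jumps of size one skip no level: shortly before level `i + 1` is reached, the clock already
shows at least `i`. -/
theorem hittingTime_lt_succ (hc : IsSimpleClock c) {i : ℕ} {a : ℝ≥0} (ha : i + 1 ≤ c a) :
    hittingTime c i < hittingTime c (i + 1) := by
  have h1 : i + 1 ≤ c (hittingTime c (i + 1)) := (hc.le_iff ha _).2 le_rfl
  have h0 : 0 < hittingTime c (i + 1) := by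
    rw [pos_iff_ne_zero]
    intro h
    rw [h, hc.zero] at h1
    omega
  obtain ⟨v, hv, hv'⟩ := hc.simple _ h0
  exact ((hc.le_iff ((Nat.le_succ i).trans ha) v).1 (by omega)).trans_lt hv

theorem hittingTime_lt_one (hc : IsSimpleClock c) {i : ℕ} (hi : i ≤ c 1) :
    hittingTime c i < 1 := by
  obtain ⟨v, hv, hv'⟩ := hc.exists_eq_one
  exact ((hc.le_iff hi v).1 (hv' ▸ hi)).trans_lt hv

/-- Inversion of the clock. At the hitting time `T` of level `i` the clock is at least `i` and at
most `n * T + ε * n`; at time `i / n + ε` it would already be at least `i`, so `T` cannot be later.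
-/
theorem abs_hittingTime_sub_le (hc : IsSimpleClock c) {n : ℕ} (hn : 0 < n) {ε : ℝ}
    (hε : ∀ u ≤ 1, |(c u : ℝ) - n * u| ≤ ε * n) {i : ℕ} (hi : i ≤ c 1) :
    |(i : ℝ) / n - hittingTime c i| ≤ ε := by
  have hn0 : (0 : ℝ) < n := by exact_mod_cast hn
  have hε0 : 0 ≤ ε := nonneg_of_mul_nonneg_left ((abs_nonneg _).trans (hε 0 zero_le_one)) hn0
  have hT1 := (hc.hittingTime_lt_one hi).le
  have h1 : (i : ℝ) ≤ c (hittingTime c i) := by exact_mod_cast (hc.le_iff hi _).2 le_rfl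
  have h2 := (abs_le.1 (hε _ hT1)).2
  rw [abs_le]
  constructor
  · by_contra! hcon
    have hlt : (i : ℝ≥0) / n + ⟨ε, hε0⟩ < hittingTime c i := by
      rw [← NNReal.coe_lt_coe]
      change (i : ℝ) / n + ε < _
      linarith
    have h3 := (abs_le.1 (hε _ (hlt.le.trans hT1))).1
    have h4 : (c ((i : ℝ≥0) / n + ⟨ε, hε0⟩) : ℝ) < i := by
      have := mt (hc.le_iff hi _).1 hlt.not_ge
      exact_mod_cast not_le.1 this
    change -(ε * n) ≤ _ - n * ((i : ℝ) / n + ε) at h3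
    have h5 : (n : ℝ) * ((i : ℝ) / n + ε) = i + ε * n := by field_simp
    rw [h5] at h3
    linarith
  · rw [sub_le_iff_le_add, div_le_iff₀ hn0]
    nlinarith

end IsSimpleClock

/-! ### Step paths: continuity, distance to a subordinated path, approximation by sampling -/

namespace SkorokhodSpace

variable {E : Type*} [PseudoEMetricSpace E]

/-- The step path `t ↦ y ⌊nt⌋`. -/
noncomputable def stepPath (n : ℕ) (y : ℕ → E) : SkorokhodSpace E :=
  subordinate y (fun t => ⌊(n : ℝ≥0) * t⌋₊) (floorClock_monotone n) (floorClock_rightContinuous n)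

theorem floor_mul_le_pred {n : ℕ} (hn : 0 < n) {u : ℝ≥0} (hu : u < 1) :
    ⌊(n : ℝ≥0) * u⌋₊ ≤ n - 1 := by
  have : ⌊(n : ℝ≥0) * u⌋₊ < n := by
    rw [Nat.floor_lt' hn.ne']
    exact mul_lt_of_lt_one_right (by exact_mod_cast hn) hu
  omega

theorem edist_stepPath_le (n : ℕ) (y y' : ℕ → E) {C : ℝ≥0∞}
    (h : ∀ k ≤ n, edist (y k) (y' k) ≤ C) : edist (stepPath n y) (stepPath n y') ≤ C := by
  have := edist_le_of_orderIso (stepPath n y) (stepPath n y') (OrderIso.refl I) (C := C) (D := 0)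
    (fun t ht => ?_) (by simp)
  · simpa using this
  · change edist (stepPath n y t) _ ≤ C
    rw [stepPath, stepPath, subordinate_apply _ _ _ _ ht, subordinate_apply _ _ _ _ ht]
    refine h _ ((Nat.floor_le_floor ?_).trans_eq (Nat.floor_natCast n))
    exact mul_le_of_le_one_right zero_le (show unitInterval.toNNReal t ≤ 1 from ht.le)

/-- Only the coordinates up to `n` matter, and the identity time change gives a uniform bound. This
is the source of all measurability into `D[0,1]`. -/
theorem continuous_stepPath (n : ℕ) : Continuous (stepPath (E := E) n) := by
  rw [continuous_iff_continuousAt]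
  intro y
  rw [ContinuousAt, EMetric.tendsto_nhds]
  intro ε hε
  obtain ⟨δ, hδ0, hδ⟩ := exists_between hε
  have : ∀ᶠ y' in 𝓝 y, ∀ k ∈ Iic n, edist (y' k) (y k) < δ := by
    rw [(finite_Iic n).eventually_all]
    intro k _
    exact (EMetric.tendsto_nhds.1 ((continuous_apply k).tendsto y)) δ hδ0
  filter_upwards [this] with y' hy'
  exact (edist_stepPath_le n _ _ fun k hk => (hy' k hk).le).trans_lt hδ

theorem measurable_stepPath [SecondCountableTopology E] [MeasurableSpace E] [BorelSpace E]
    (n : ℕ) : Measurable (stepPath (E := E) n) :=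
  (continuous_stepPath n).measurable

theorem edist_stepPath_subordinate_le (y : ℕ → E) {c : ℝ≥0 → ℕ} (hc : IsSimpleClock c) {n : ℕ}
    (hn : 0 < n) {ε : ℝ} (hε : ∀ u ≤ 1, |(c u : ℝ) - n * u| ≤ ε * n) {C : ℝ≥0∞}
    (hC : ∀ j, min (n - 1) (c 1) ≤ j → j ≤ max (n - 1) (c 1) →
      edist (y j) (y (min (n - 1) (c 1))) ≤ C) :
    edist (stepPath n y) (subordinate y c hc.monotone hc.right_continuous)
      ≤ max C (ENNReal.ofReal ε) := by
  have hn0 : (0 : ℝ) < n := by exact_mod_cast hn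
  refine edist_subordinate_le y _ _ _ _ (r := min (n - 1) (c 1)) (s := fun i => (i : ℝ) / n)
    (t := fun i => hittingTime c i) (fun i hi => ?_) (fun i hi => ?_) (by simp)
    (by simp [hittingTime_zero]) ?_ ?_ (fun u hu i hi => ?_) (fun u hu i hi => ?_)
    (fun i hi => ?_) (fun u hu v hv h1 h2 => ?_)
  · push_cast
    gcongr
    linarith
  · exact_mod_cast hc.hittingTime_lt_succ (a := 1) (by omega)
  · rw [div_lt_one hn0]
    exact_mod_cast (show min (n - 1) (c 1) < n by omega)
  · exact_mod_cast hc.hittingTime_lt_one (min_le_right _ _)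
  · rw [Nat.le_floor_iff zero_le, div_le_iff₀ hn0, mul_comm, ← NNReal.coe_le_coe]
    push_cast
    rfl
  · exact_mod_cast hc.le_iff (a := 1) (by omega) u
  · exact hc.abs_hittingTime_sub_le hn hε (by omega)
  · have h3 := floor_mul_le_pred hn hu
    have h4 : c v ≤ c 1 := hc.monotone hv.le
    -- The clock with the smaller final value has stopped at `min (n - 1) (c 1)`; only the other one
    -- still moves.
    rcases le_total (n - 1) (c 1) with h | h
    · rw [show ⌊(n : ℝ≥0) * u⌋₊ = min (n - 1) (c 1) by omega, edist_comm]
      exact hC _ h2 (by omega)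
    · rw [show c v = min (n - 1) (c 1) by omega]
      exact hC _ h1 (by omega)

/-- Sampling a step path on finer and finer grids recovers the path in the limit. -/
theorem tendsto_stepPath_sample (y : ℕ → E) {c : ℝ≥0 → ℕ} (hc : IsSimpleClock c) :
    Tendsto (fun m : ℕ => stepPath (m + 1) fun k => y (c (k / (m + 1 : ℕ)))) atTop
      (𝓝 (subordinate y c hc.monotone hc.right_continuous)) := by
  -- The sampled clock reaches level `i` at the first grid point not before the hitting time of `i`.
  let s : ℕ → ℕ → ℝ := fun m i => (⌈((m + 1 : ℕ) : ℝ≥0) * hittingTime c i⌉₊ : ℝ) / (m + 1 : ℕ)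
  have hs : ∀ m i, |s m i - hittingTime c i| ≤ 1 / ((m : ℝ) + 1) := by
    intro m i
    have hm : (0 : ℝ) < m + 1 := by positivity
    have h1 : ((m : ℝ) + 1) * hittingTime c i ≤ ⌈((m + 1 : ℕ) : ℝ≥0) * hittingTime c i⌉₊ := by
      exact_mod_cast Nat.le_ceil (((m + 1 : ℕ) : ℝ≥0) * hittingTime c i)
    have h2 : (⌈((m + 1 : ℕ) : ℝ≥0) * hittingTime c i⌉₊ : ℝ)
        < ((m : ℝ) + 1) * hittingTime c i + 1 := by
      exact_mod_cast Nat.ceil_lt_add_one (zero_le (a := ((m + 1 : ℕ) : ℝ≥0) * hittingTime c i))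
    have e : s m i = (⌈((m + 1 : ℕ) : ℝ≥0) * hittingTime c i⌉₊ : ℝ) / (m + 1) := by
      simp [s]
    rw [e, abs_le]
    constructor
    · have : (hittingTime c i : ℝ) ≤ (⌈((m + 1 : ℕ) : ℝ≥0) * hittingTime c i⌉₊ : ℝ) / (m + 1) := by
        rw [le_div_iff₀ hm]
        linarith
      have : 0 ≤ 1 / ((m : ℝ) + 1) := by positivity
      linarith
    · rw [sub_le_iff_le_add, div_le_iff₀ hm, add_mul, div_mul_cancel₀ _ hm.ne']
      linarith
  have hlim : ∀ i, Tendsto (fun m => s m i) atTop (𝓝 (hittingTime c i)) := fun i =>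
    tendsto_iff_dist_tendsto_zero.2 (squeeze_zero (fun _ => dist_nonneg) (fun m => hs m i)
      tendsto_one_div_add_atTop_nhds_zero_nat)
  -- Rounding up to the grid might merge nodes or push the last one to `1`. As there are finitely
  -- many levels, neither happens for large `m`.
  have hev1 : ∀ᶠ m in atTop, ∀ i ∈ Iio (c 1), s m i < s m (i + 1) := by
    rw [(finite_Iio (c 1)).eventually_all]
    intro i hi
    have : hittingTime c i < hittingTime c (i + 1) :=
      hc.hittingTime_lt_succ (a := 1) (Nat.succ_le_of_lt hi)
    exact (hlim i).eventually_lt (hlim (i + 1)) (by exact_mod_cast this)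
  have hev2 : ∀ᶠ m in atTop, s m (c 1) < 1 :=
    (hlim (c 1)).eventually_lt tendsto_const_nhds (by exact_mod_cast hc.hittingTime_lt_one le_rfl)
  refine tendsto_iff_edist_tendsto_0.2 ?_
  refine tendsto_of_tendsto_of_tendsto_of_le_of_le' tendsto_const_nhds
    (h := fun m : ℕ => ENNReal.ofReal (1 / ((m : ℝ) + 1))) ?_
    (Eventually.of_forall fun _ => zero_le) ?_
  · rw [← ENNReal.ofReal_zero]
    exact ENNReal.tendsto_ofReal tendsto_one_div_add_atTop_nhds_zero_nat
  filter_upwards [hev1, hev2] with m h1 h2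
  have hm : (0 : ℝ≥0) < (m + 1 : ℕ) := by positivity
  have hmono : Monotone fun u : ℝ≥0 => c (⌊((m + 1 : ℕ) : ℝ≥0) * u⌋₊ / (m + 1 : ℕ)) := by
    intro u v huv
    refine hc.monotone ?_
    gcongr
  have hcont : ∀ t, ContinuousWithinAt
      (fun u : ℝ≥0 => c (⌊((m + 1 : ℕ) : ℝ≥0) * u⌋₊ / (m + 1 : ℕ))) (Ici t) t := fun t =>
    (continuous_of_discreteTopology
      (f := fun k : ℕ => c (k / (m + 1 : ℕ)))).continuousAt.comp_continuousWithinAt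
      (floorClock_rightContinuous (m + 1) t)
  have hfl : ∀ u : ℝ≥0, (⌊((m + 1 : ℕ) : ℝ≥0) * u⌋₊ : ℝ≥0) / (m + 1 : ℕ) ≤ u := by
    intro u
    rw [div_le_iff₀ hm, mul_comm u]
    exact Nat.floor_le zero_le
  -- With `r = c 1` both clocks are constant after the last node, so the spatial error is `C = 0`.
  have := edist_subordinate_le y hmono hcont hc.monotone hc.right_continuous (r := c 1)
    (s := s m) (t := fun i => hittingTime c i) (D := 1 / ((m : ℝ) + 1)) (C := 0)
    (fun i hi => h1 i hi) (fun i hi => ?_) (by simp [s, hittingTime_zero])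
    (by simp [hittingTime_zero]) h2 (by exact_mod_cast hc.hittingTime_lt_one le_rfl)
    (fun u hu i hi => ?_) (fun u hu i hi => ?_) (fun i hi => hs m i)
    (fun u hu v hv h3 h4 => ?_)
  · rw [max_eq_right zero_le] at this
    exact this
  · exact_mod_cast hc.hittingTime_lt_succ (a := 1) (Nat.succ_le_of_lt hi)
  · rw [hc.le_iff hi, le_div_iff₀ hm, mul_comm, ← Nat.ceil_le, Nat.le_floor_iff zero_le]
    simp only [s]
    rw [div_le_iff₀ (by positivity), mul_comm (u : ℝ), ← NNReal.coe_le_coe]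
    push_cast
    rfl
  · exact_mod_cast hc.le_iff hi u
  · have h5 := hc.monotone ((hfl u).trans hu.le)
    have h6 := hc.monotone hv.le
    rw [le_antisymm h5 h3, le_antisymm h6 h4, edist_self]

end SkorokhodSpace

/-! ### Measurability of the two embeddings -/

section Embeddings

variable {Ω : Type*} [MeasurableSpace Ω] {P : Measure Ω} {N : ℝ≥0 → Ω → ℕ}

theorem IsPoissonProcess.ae_isSimpleClock (hN : IsPoissonProcess 1 N P) (n : ℕ) :
    ∀ᵐ ω ∂P, IsSimpleClock fun t => N (n * t) ω := by
  have hmono : ∀ ω, Monotone fun t : ℝ≥0 => N (n * t) ω := fun ω _ _ h =>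
    hN.monotone ω (mul_le_mul_right h _)
  have hcont : ∀ ω (t : ℝ≥0), ContinuousWithinAt (fun t : ℝ≥0 => N (n * t) ω) (Ici t) t :=
    fun ω t => (hN.right_continuous ω (n * t)).tendsto.comp <| tendsto_nhdsWithin_iff.2
      ⟨((continuous_const_mul (n : ℝ≥0)).tendsto t).mono_left nhdsWithin_le_nhds,
        eventually_mem_nhdsWithin.mono fun s (h : t ≤ s) => mul_le_mul_right h (n : ℝ≥0)⟩
  rcases Nat.eq_zero_or_pos n with rfl | hn
  · refine ae_of_all _ fun ω => ⟨hmono ω, hcont ω, by simp [hN.zero], fun u hu => ⟨0, hu, ?_⟩,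
      ⟨0, zero_lt_one, ?_⟩⟩ <;> simp [hN.zero]
  · have hn0 : (0 : ℝ≥0) < n := by exact_mod_cast hn
    filter_upwards [hN.ae_simple, hN.ae_exists_lt_eq hn0] with ω h1 h2
    refine ⟨hmono ω, hcont ω, by simp [hN.zero], fun u hu => ?_, ?_⟩
    · obtain ⟨v, hv, hv'⟩ := h1 (n * u) (by positivity)
      refine ⟨v / n, (div_lt_iff₀' hn0).2 hv, ?_⟩
      simpa [mul_div_cancel₀ v hn0.ne'] using hv'
    · obtain ⟨v, hv, hv'⟩ := h2
      refine ⟨v / n, (div_lt_one hn0).2 hv, ?_⟩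
      simpa [mul_div_cancel₀ v hn0.ne'] using hv'

theorem measurable_comp_count {E : Type*} [MeasurableSpace E] {Y : ℕ → Ω → E}
    (hY : ∀ k, Measurable (Y k)) {g : Ω → ℕ} (hg : Measurable g) :
    Measurable fun ω => Y (g ω) ω := by
  have h : Measurable (Function.uncurry Y) := measurable_from_prod_countable_right hY
  exact h.comp (hg.prodMk measurable_id)

variable {E : Type*} [PseudoEMetricSpace E] [SecondCountableTopology E] [MeasurableSpace E]
  [BorelSpace E] {Y : ℕ → Ω → E}

theorem measurable_stepEmbedding (hY : ∀ k, Measurable (Y k)) (n : ℕ) :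
    Measurable (stepEmbedding Y n) :=
  (SkorokhodSpace.measurable_stepPath n).comp (measurable_pi_iff.2 hY)

/-- Almost surely the path is the `J₁` limit of its samples on finer and finer grids, and each
sample is a continuous function of a measurable random sequence. -/
theorem aemeasurable_markovEmbedding (hN : IsPoissonProcess 1 N P) (hY : ∀ k, Measurable (Y k))
    (n : ℕ) : AEMeasurable (markovEmbedding hN Y n) P := by
  refine aemeasurable_of_tendsto_metrizable_ae' (f := fun (m : ℕ) ω =>
    SkorokhodSpace.stepPath (m + 1) fun k => Y (N (n * (k / (m + 1 : ℕ))) ω) ω)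
    (fun m => Measurable.aemeasurable ?_) ?_
  · exact (SkorokhodSpace.measurable_stepPath (m + 1)).comp
      (measurable_pi_iff.2 fun k => measurable_comp_count hY (hN.measurable _))
  · filter_upwards [hN.ae_isSimpleClock n] with ω hω
    exact SkorokhodSpace.tendsto_stepPath_sample (fun k => Y k ω) hω

end Embeddings

/-! ### Convergence in distribution and oscillation near time one -/

section WeakConvergence

variable {Ω : Type*} [MeasurableSpace Ω] {P : Measure Ω} [IsProbabilityMeasure P]

theorem eventually_measure_preimage_lt {S : Type*} [TopologicalSpace S] [HasOuterApproxClosed S]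
    [MeasurableSpace S] [OpensMeasurableSpace S] {X : ℕ → Ω → S} {L : ProbabilityMeasure S}
    (hX : TendstoInDistribution X atTop id (fun _ => P) (L : Measure S)) {F : Set S}
    (hF : IsClosed F) {a : ℝ≥0∞} (ha : (L : Measure S) F < a) :
    ∀ᶠ n in atTop, P (X n ⁻¹' F) < a := by
  have h := ProbabilityMeasure.limsup_measure_closed_le_of_tendsto hX.tendsto hF
  simp only [ProbabilityMeasure.coe_mk, Measure.map_id] at h
  filter_upwards [eventually_lt_of_limsup_lt (h.trans_lt ha)] with n hn
  rwa [Measure.map_apply_of_aemeasurable (hX.forall_aemeasurable n) hF.measurableSet] at hn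

/-- If `X n` converges in distribution and `edist (X n) (Z n)` tends to `0` in probability, then
`Z n` converges in distribution to the same limit. -/
theorem tendstoInDistribution_of_edist {S : Type*} [PseudoEMetricSpace S] [MeasurableSpace S]
    [BorelSpace S] {X Z : ℕ → Ω → S} {L : ProbabilityMeasure S}
    (hX : TendstoInDistribution X atTop id (fun _ => P) (L : Measure S))
    (hZ : ∀ n, AEMeasurable (Z n) P)
    (hd : ∀ ε > 0, Tendsto (fun n => P {ω | ε ≤ edist (X n ω) (Z n ω)}) atTop (𝓝 0)) :
    TendstoInDistribution Z atTop id (fun _ => P) (L : Measure S) := by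
  refine ⟨hZ, aemeasurable_id, tendsto_of_forall_isClosed_limsup_le' fun F hF => ?_⟩
  simp only [ProbabilityMeasure.coe_mk, Measure.map_id]
  refine le_of_forall_gt_imp_ge_of_dense fun a ha => ?_
  obtain ⟨b, hb, hba⟩ := exists_between ha
  -- The closed thickenings of `F` shrink to `F`, so one of them still has `L`-measure below `b`. If
  -- `Z n` is in `F`, then `X n` is in this thickening or at least `δ` away from `Z n`.
  have hthick := tendsto_measure_cthickening_of_isClosed (μ := (L : Measure S))
    ⟨1, one_pos, measure_ne_top _ _⟩ hF
  obtain ⟨δ, hδ, hδ0⟩ := (((hthick.mono_left nhdsWithin_le_nhds).eventually_lt_const hb).and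
    (self_mem_nhdsWithin (s := Ioi (0 : ℝ)))).exists
  refine limsup_le_of_le (h := ?_)
  filter_upwards [eventually_measure_preimage_lt hX Metric.isClosed_cthickening hδ,
    ENNReal.tendsto_nhds_zero.1 (hd (ENNReal.ofReal δ) (ENNReal.ofReal_pos.2 hδ0)) (a - b)
      (tsub_pos_of_lt hba)] with n h1 h2
  rw [Measure.map_apply_of_aemeasurable (hZ n) hF.measurableSet]
  have hsub : Z n ⁻¹' F ⊆ X n ⁻¹' Metric.cthickening δ F ∪
      {ω | ENNReal.ofReal δ ≤ edist (X n ω) (Z n ω)} := by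
    intro ω hω
    rcases le_total (ENNReal.ofReal δ) (edist (X n ω) (Z n ω)) with h | h
    · exact Or.inr h
    · exact Or.inl (Metric.mem_cthickening_of_edist_le _ _ _ _ hω h)
  calc P (Z n ⁻¹' F) ≤ _ := measure_mono hsub
    _ ≤ b + (a - b) := (measure_union_le _ _).trans (add_le_add h1.le h2)
    _ = a := add_tsub_cancel_of_le hba.le

namespace SkorokhodSpace

variable {E : Type*} [PseudoEMetricSpace E]

/-- The paths that oscillate by at least `ε` over `[1 - δ, 1]`. -/
def endOscillation (δ : ℝ) (ε : ℝ≥0∞) : Set (SkorokhodSpace E) :=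
  {f | ∃ u v : I, 1 - δ ≤ u ∧ 1 - δ ≤ v ∧ ε ≤ edist (f u) (f v)}

theorem endOscillation_mono {δ δ' : ℝ} (h : δ ≤ δ') (ε : ℝ≥0∞) :
    endOscillation (E := E) δ ε ⊆ endOscillation δ' ε := by
  rintro f ⟨u, v, hu, hv, huv⟩
  exact ⟨u, v, by linarith, by linarith, huv⟩

theorem exists_forall_edist_one_lt (g : SkorokhodSpace E) {a : ℝ≥0∞} (ha : 0 < a) :
    ∃ δ > (0 : ℝ), ∀ u : I, 1 - δ ≤ u → edist (g u) (g 1) < a := by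
  have h : ∀ᶠ u in 𝓝[<] (1 : I), edist (g u) (g 1) < a :=
    (EMetric.tendsto_nhds.1 g.left_continuous_one) a ha
  obtain ⟨b, hb, hb'⟩ := (mem_nhdsLT_iff_exists_Ioo_subset' (zero_lt_one (α := I))).1 h
  have hb1 : (b : ℝ) < 1 := hb
  refine ⟨(1 - b) / 2, by linarith, fun u hu => ?_⟩
  rcases lt_or_eq_of_le (unitInterval.le_one' (t := u)) with h1 | rfl
  · refine hb' ⟨?_, h1⟩
    rw [← Subtype.coe_lt_coe]
    linarith
  · simpa using ha

/-- A path `g` in the intersection would be `J₁`-close to paths oscillating by `ε` arbitrarily near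
`1`. A small time change keeps the relevant times where `g` is almost `g 1`, so `g` would violate
left continuity at `1`. -/
theorem iInter_closure_endOscillation {ε : ℝ≥0} (hε : 0 < ε) :
    ⋂ k : ℕ, closure (endOscillation (E := E) (1 / ((k : ℝ) + 1)) ε) = ∅ := by
  refine eq_empty_of_forall_notMem fun g hg => ?_
  -- The triangle inequality below collects four errors of size `ε / 8`, in total less than `ε`.
  have ha : (0 : ℝ≥0∞) < (ε / 8 : ℝ≥0) := by
    exact_mod_cast (show 0 < ε / 8 by positivity)
  obtain ⟨δ, hδ, hg1⟩ := g.exists_forall_edist_one_lt ha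
  obtain ⟨k, hk⟩ := exists_nat_one_div_lt (show (0 : ℝ) < δ / 2 by positivity)
  obtain ⟨f, ⟨u, v, hu, hv, huv⟩, hfg⟩ := EMetric.mem_closure_iff.1 (mem_iInter.1 hg k)
    (min (ε / 8 : ℝ≥0) (ENNReal.ofReal (δ / 2))) (lt_min ha (ENNReal.ofReal_pos.2 (by positivity)))
  obtain ⟨l, hl⟩ := iInf_lt_iff.1 (show distJ1 g f < _ from hfg)
  have h1 : ∀ t, edist (g (l t)) (f t) ≤ (ε / 8 : ℝ≥0) := fun t =>
    ((le_iSup (fun t => edist (g (l t)) (f t)) t).trans le_sup_left).trans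
      (hl.le.trans (min_le_left _ _))
  have h2 : ∀ t : I, |(l t : ℝ) - t| ≤ δ / 2 := fun t => by
    have : edist (l t) t ≤ ENNReal.ofReal (δ / 2) :=
      ((le_iSup (fun t => edist (l t) t) t).trans le_sup_right).trans
        (hl.le.trans (min_le_right _ _))
    rw [edist_dist, ENNReal.ofReal_le_ofReal_iff (by positivity)] at this
    exact this
  have h3 : ∀ t : I, 1 - 1 / ((k : ℝ) + 1) ≤ t → edist (g (l t)) (g 1) ≤ (ε / 8 : ℝ≥0) := by
    intro t ht
    have := (abs_le.1 (h2 t)).1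
    exact (hg1 _ (by linarith)).le
  have h4 : (ε : ℝ≥0∞) ≤ ((ε / 8 + (ε / 8 + (ε / 8 + ε / 8)) : ℝ≥0) : ℝ≥0∞) := by
    rw [ENNReal.coe_add, ENNReal.coe_add, ENNReal.coe_add]
    refine huv.trans ((edist_triangle _ (g (l u)) _).trans (add_le_add ?_ ?_))
    · rw [edist_comm]
      exact h1 u
    refine (edist_triangle _ (g 1) _).trans (add_le_add (h3 u hu) ?_)
    refine (edist_triangle _ (g (l v)) _).trans (add_le_add ?_ (h1 v))
    rw [edist_comm]
    exact h3 v hv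
  have h5 : (ε : ℝ) ≤ ε / 8 + (ε / 8 + (ε / 8 + ε / 8)) := by exact_mod_cast h4
  have h6 : (0 : ℝ) < ε := hε
  linarith

/-- Along a sequence that converges in distribution, the oscillation near time `1` is small. -/
theorem exists_measure_endOscillation_le {X : ℕ → Ω → SkorokhodSpace E}
    {L : ProbabilityMeasure (SkorokhodSpace E)}
    (hX : TendstoInDistribution X atTop id (fun _ => P) (L : Measure _)) {ε : ℝ≥0} (hε : 0 < ε)
    {a : ℝ≥0∞} (ha : 0 < a) :
    ∃ δ > (0 : ℝ), ∀ᶠ n in atTop, P (X n ⁻¹' endOscillation δ ε) ≤ a := by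
  have hanti : Antitone fun k : ℕ =>
      closure (endOscillation (E := E) (1 / ((k : ℝ) + 1)) ε) := fun k m hkm =>
    closure_mono (endOscillation_mono (by gcongr) _)
  have h := tendsto_measure_iInter_atTop (μ := (L : Measure (SkorokhodSpace E)))
    (fun k => isClosed_closure.measurableSet.nullMeasurableSet) hanti ⟨0, measure_ne_top _ _⟩
  rw [iInter_closure_endOscillation hε, measure_empty] at h
  obtain ⟨k, hk⟩ := (h.eventually_lt_const ha).exists
  refine ⟨1 / ((k : ℝ) + 1), by positivity, ?_⟩
  filter_upwards [eventually_measure_preimage_lt hX isClosed_closure hk] with n hn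
  exact (measure_mono (preimage_mono subset_closure)).trans hn.le

end SkorokhodSpace

end WeakConvergence

/-! ### The step from index `n - 2` to `n - 1` -/

section LastStep

variable {Ω : Type*} [MeasurableSpace Ω] {P : Measure Ω} {N : ℝ≥0 → Ω → ℕ} {E : Type*}
  [PseudoEMetricSpace E]

open SkorokhodSpace in
theorem mem_endOscillation_markovEmbedding (hN : IsPoissonProcess 1 N P) {Y : ℕ → Ω → E} {n : ℕ}
    (hn2 : 2 ≤ n) {ω : Ω} (hc : IsSimpleClock fun t => N (n * t) ω) {δ : ℝ} (hδ : 4 ≤ δ * n)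
    (hdev : ∀ t : ℝ≥0, t ≤ n → |(N t ω : ℝ) - t| ≤ δ / 2 * n) (hNn : n ≤ N n ω) {ε : ℝ≥0∞}
    (hε : ε ≤ edist (Y (n - 2) ω) (Y (n - 1) ω)) :
    markovEmbedding hN Y n ω ∈ endOscillation δ ε := by
  have hn0 : (0 : ℝ) < n := by exact_mod_cast (show 0 < n by omega)
  have hdev' : ∀ u : ℝ≥0, u ≤ 1 → |(N (n * u) ω : ℝ) - n * u| ≤ δ / 2 * n := fun u hu => by
    simpa using hdev (n * u) (mul_le_of_le_one_right zero_le hu)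
  have hNn' : n ≤ N (n * 1) ω := by rwa [mul_one]
  have key : ∀ i, i < n → n ≤ i + 2 → ∃ u : I, 1 - δ ≤ u ∧
      markovEmbedding hN Y n ω u = Y i ω := by
    intro i hi hi2
    have hi1 : i ≤ N (n * 1) ω := by omega
    have hlt := hc.hittingTime_lt_one hi1
    set T := hittingTime (fun t => N (n * t) ω) i with hT
    have hlt' : (T : ℝ) < 1 := hlt
    refine ⟨⟨T, T.2, hlt'.le⟩, ?_, ?_⟩
    · have h1 := (abs_le.1 (hc.abs_hittingTime_sub_le (by omega) hdev' hi1)).2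
      -- Here `i ≥ n - 2`, and `4 ≤ δ * n` means `2 / n ≤ δ / 2`. The deviation of the clock uses up
      -- the other `δ / 2`.
      have h2 : 1 - δ / 2 ≤ (i : ℝ) / n := by
        rw [le_div_iff₀ hn0]
        have : (n : ℝ) ≤ i + 2 := by exact_mod_cast hi2
        linarith
      change 1 - δ ≤ (T : ℝ)
      linarith
    · refine (subordinate_apply (fun k => Y k ω) _ hc.monotone hc.right_continuous
        (t := ⟨T, T.2, hlt'.le⟩) hlt').trans ?_
      change Y (N (n * T) ω) ω = Y i ω
      congr 1
      have h1 : i ≤ N (n * T) ω := (hc.le_iff hi1 T).2 le_rfl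
      -- Since `N n ≥ n`, level `i + 1` is reached too, and strictly later, so the clock shows
      -- exactly `i` at time `T`.
      have h2 : ¬ i + 1 ≤ N (n * T) ω := by
        have hi1' : i + 1 ≤ N (n * 1) ω := by omega
        exact mt (hc.le_iff hi1' T).1 (hc.hittingTime_lt_succ hi1').not_ge
      omega
  obtain ⟨u, hu, hu'⟩ := key (n - 2) (by omega) (by omega)
  obtain ⟨v, hv, hv'⟩ := key (n - 1) (by omega) (by omega)
  refine ⟨u, v, hu, hv, ?_⟩
  rw [hu', hv']
  exact hε

variable [IsProbabilityMeasure P]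

open SkorokhodSpace in
-- The values at the times `(n - 2) / n` and `(n - 1) / n` are those of the last step, and both
-- times tend to `1`.
theorem tendsto_lastStep_of_stepEmbedding {Y : ℕ → ℕ → Ω → E}
    {L : ProbabilityMeasure (SkorokhodSpace E)}
    (hX : TendstoInDistribution (fun n => stepEmbedding (Y n) n) atTop id (fun _ => P)
      (L : Measure _)) {ε : ℝ≥0} (hε : 0 < ε) :
    Tendsto (fun n => P {ω | ε ≤ edist (Y n (n - 2) ω) (Y n (n - 1) ω)}) atTop (𝓝 0) := by
  refine ENNReal.tendsto_nhds_zero.2 fun a ha => ?_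
  obtain ⟨δ, hδ, hev⟩ := exists_measure_endOscillation_le hX hε ha
  obtain ⟨n₀, hn₀⟩ := exists_nat_ge (2 / δ)
  filter_upwards [hev, eventually_ge_atTop (max 2 n₀)] with n hn hn2
  refine (measure_mono fun ω hω => ?_).trans hn
  have h2 : 2 ≤ n := (le_max_left _ _).trans hn2
  have hn0 : (0 : ℝ) < n := by exact_mod_cast (show 0 < n by omega)
  have hn0' : (n : ℝ≥0) ≠ 0 := by exact_mod_cast (show n ≠ 0 by omega)
  have hδn : 2 ≤ δ * n := by
    rw [div_le_iff₀ hδ] at hn₀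
    have : (n₀ : ℝ) ≤ n := by exact_mod_cast (le_max_right _ _).trans hn2
    nlinarith
  have key : ∀ i, i < n → n ≤ i + 2 → ∃ u : I, 1 - δ ≤ u ∧
      stepEmbedding (Y n) n ω u = Y n i ω := by
    intro i hi hi2
    have hlt : (i : ℝ) / n < 1 := (div_lt_one hn0).2 (by exact_mod_cast hi)
    refine ⟨⟨(i : ℝ) / n, by positivity, hlt.le⟩, ?_, ?_⟩
    · rw [le_div_iff₀ hn0]
      have : (n : ℝ) ≤ i + 2 := by exact_mod_cast hi2
      linarith
    · rw [stepEmbedding, subordinate_apply _ _ _ _ hlt]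
      congr 1
      have e : unitInterval.toNNReal ⟨(i : ℝ) / n, by positivity, hlt.le⟩ = (i : ℝ≥0) / n :=
        NNReal.eq (by simp)
      rw [e, mul_div_cancel₀ _ hn0', Nat.floor_natCast]
  obtain ⟨u, hu, hu'⟩ := key (n - 2) (by omega) (by omega)
  obtain ⟨v, hv, hv'⟩ := key (n - 1) (by omega) (by omega)
  refine ⟨u, v, hu, hv, ?_⟩
  simp only [hu', hv']
  exact hω

variable [SecondCountableTopology E] [MeasurableSpace E] [BorelSpace E]

open SkorokhodSpace in
-- The Markov embedding shows the last step near time `1` only when `N n ≥ n` and the clock is near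
-- its mean. Independence of `N n ≥ n` from the chain, and its probability of at least `1 / 2`,
-- remove the first restriction at the cost of a factor `2`.
theorem tendsto_lastStep_of_markovEmbedding (hN : IsPoissonProcess 1 N P) {Y : ℕ → ℕ → Ω → E}
    (hindep : ∀ n, IndepFun (fun ω k => Y n k ω) (fun ω t => N t ω) P)
    {L : ProbabilityMeasure (SkorokhodSpace E)}
    (hZ : TendstoInDistribution (fun n => markovEmbedding hN (Y n) n) atTop id (fun _ => P)
      (L : Measure _)) {ε : ℝ≥0} (hε : 0 < ε) :
    Tendsto (fun n => P {ω | ε ≤ edist (Y n (n - 2) ω) (Y n (n - 1) ω)}) atTop (𝓝 0) := by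
  refine ENNReal.tendsto_nhds_zero.2 fun a ha => ?_
  -- Two errors, oscillation and clock deviation, each doubled on dividing by `P B ≥ 1 / 2`.
  have ha4 : 0 < a / 4 := ENNReal.div_pos ha.ne' (by simp)
  obtain ⟨δ, hδ, hev⟩ := exists_measure_endOscillation_le hZ hε ha4
  obtain ⟨n₀, hn₀⟩ := exists_nat_ge (4 / δ)
  filter_upwards [hev, eventually_ge_atTop (max 2 n₀), ENNReal.tendsto_nhds_zero.1
    (hN.tendsto_measure_deviation (half_pos hδ)) _ ha4] with n hn hn2 hdev
  have h2 : 2 ≤ n := (le_max_left _ _).trans hn2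
  have hδn : 4 ≤ δ * n := by
    rw [div_le_iff₀ hδ] at hn₀
    have : (n₀ : ℝ) ≤ n := by exact_mod_cast (le_max_right _ _).trans hn2
    nlinarith
  set A := {ω | (ε : ℝ≥0∞) ≤ edist (Y n (n - 2) ω) (Y n (n - 1) ω)}
  set B := {ω | N n ω ∈ {k | n ≤ k}}
  have hAB : P (A ∩ B) = P A * P B := by
    refine (hindep n).measure_inter_preimage_eq_mul {y | (ε : ℝ≥0∞) ≤ edist (y (n - 2)) (y (n - 1))}
      {c | c n ∈ {k | n ≤ k}} ?_ ?_
    · exact measurableSet_le measurable_const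
        ((measurable_pi_apply (n - 2)).edist (measurable_pi_apply (n - 1)))
    · exact measurable_pi_apply (n : ℝ≥0) (MeasurableSet.of_discrete (s := {k | n ≤ k}))
  have hB : 1 / 2 ≤ P B := by
    rw [hN.measure_count, ← ofReal_measureReal]
    refine le_trans (le_of_eq ?_) (ENNReal.ofReal_le_ofReal (half_le_poissonMeasure_ge n))
    rw [ENNReal.ofReal_div_of_pos two_pos]
    simp
  have hsub : (A ∩ B : Set Ω) ≤ᵐ[P] (markovEmbedding hN (Y n) n ⁻¹' endOscillation δ ε ∪
      {ω | ∃ t : ℝ≥0, t ≤ n ∧ δ / 2 * n < |(N t ω : ℝ) - t|} : Set Ω) := by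
    filter_upwards [hN.ae_isSimpleClock n] with ω hc hω
    by_cases h : ∃ t : ℝ≥0, t ≤ n ∧ δ / 2 * n < |(N t ω : ℝ) - t|
    · exact Or.inr h
    · push Not at h
      exact Or.inl (mem_endOscillation_markovEmbedding hN h2 hc hδn h hω.2 hω.1)
  have hle : P A * (1 / 2) ≤ a / 4 + a / 4 := by
    calc P A * (1 / 2) ≤ P A * P B := by gcongr
      _ = P (A ∩ B) := hAB.symm
      _ ≤ _ := measure_mono_ae hsub
      _ ≤ _ := (measure_union_le _ _).trans (add_le_add hn hdev)
  calc P A = P A * (1 / 2) * 2 := by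
        rw [mul_assoc, one_div, ENNReal.inv_mul_cancel two_ne_zero (by simp), mul_one]
    _ ≤ (a / 4 + a / 4) * 2 := by gcongr
    _ = a := by
      rw [← two_mul, mul_comm, ← mul_assoc, show (2 : ℝ≥0∞) * 2 = 4 by norm_num,
        ENNReal.mul_div_cancel (by simp) (by simp)]

end LastStep

/-! ### The extra steps and the distance between the embeddings -/

section ExtraSteps

/-- The strict inequality in the range of `k` leaves out the index `max (n - 1) (countBefore N n
ω)`, hence `j + 1` in the bound. -/
theorem edist_le_of_extraSteps_lt {Ω E : Type*} [SeminormedAddCommGroup E] {N : ℝ≥0 → Ω → ℕ}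
    {Y : ℕ → Ω → E} {n : ℕ} {ω : Ω} {ε : ℝ≥0}
    (h : extraSteps Y N n ω < ε) {j : ℕ} (hj : min (n - 1) (countBefore N n ω) ≤ j)
    (hj' : j + 1 ≤ max (n - 1) (countBefore N n ω)) (hn : 0 < n) :
    edist (Y j ω) (Y (min (n - 1) (countBefore N n ω)) ω) ≤ ε := by
  set M := min (n - 1) (countBefore N n ω)
  have hk : j - M ∈ Finset.range ((n : ℤ) - 1 - (countBefore N n ω : ℤ)).natAbs := by
    rw [Finset.mem_range]
    omega
  have h1 := (Finset.le_sup (f := fun k => ‖Y (M + k) ω - Y M ω‖₊) hk).trans_lt h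
  rw [Nat.add_sub_cancel' hj] at h1
  rw [edist_nndist, nndist_eq_nnnorm]
  exact_mod_cast h1.le

variable {Ω : Type*} [MeasurableSpace Ω] {P : Measure Ω} {N : ℝ≥0 → Ω → ℕ} {E : Type*}

theorem IsPoissonProcess.ae_countBefore_eq (hN : IsPoissonProcess 1 N P) {t : ℝ≥0} (ht : 0 < t) :
    ∀ᵐ ω ∂P, countBefore N t ω = N t ω := by
  filter_upwards [hN.ae_exists_lt_eq ht] with ω ⟨v, hv, hv'⟩
  refine le_antisymm ((hN.monotone ω).leftLim_le le_rfl) ?_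
  rw [← hv']
  exact (hN.monotone ω).le_leftLim hv

/-- The ratio of the two weights is `(m + 1) / n ≤ (2 * n + 1) / n ≤ 3`. -/
theorem measure_count_le_three_mul_succ (hN : IsPoissonProcess 1 N P) {n m : ℕ} (hn : 0 < n)
    (hm : m ≤ 2 * n) : P {ω | N n ω ∈ ({m} : Set ℕ)} ≤ 3 * P {ω | N n ω ∈ ({m + 1} : Set ℕ)} := by
  rw [hN.measure_count, hN.measure_count, ← ofReal_measureReal, ← ofReal_measureReal,
    ← ENNReal.ofReal_ofNat, ← ENNReal.ofReal_mul (by norm_num)]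
  refine ENNReal.ofReal_le_ofReal ?_
  have h := poissonMeasure_singleton_succ n m
  have hn1 : (1 : ℝ) ≤ n := by exact_mod_cast hn
  have hm' : (m : ℝ) ≤ 2 * n := by exact_mod_cast hm
  have h0 : 0 ≤ (poissonMeasure (n : ℝ≥0)).real {m + 1} := measureReal_nonneg
  rw [NNReal.coe_natCast] at h
  refine le_of_mul_le_mul_left ?_ (show (0 : ℝ) < n by linarith)
  rw [← h]
  nlinarith

variable [NormedAddCommGroup E]

theorem edist_stepEmbedding_markovEmbedding_le (hN : IsPoissonProcess 1 N P) {Y : ℕ → Ω → E}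
    {n : ℕ} (hn : 0 < n) {ω : Ω} {ε : ℝ≥0} (hc : IsSimpleClock fun t => N (n * t) ω)
    (hcount : countBefore N n ω = N n ω) (hextra : extraSteps Y N n ω < ε)
    (hlast : edist (Y (n - 2) ω) (Y (n - 1) ω) ≤ ε)
    (hover : n ≤ N n ω → ∀ k ≤ N n ω - (n - 1), ‖Y (n - 1 + k) ω - Y (n - 1) ω‖₊ ≤ ε)
    (hdev : ∀ t : ℝ≥0, t ≤ n → |(N t ω : ℝ) - t| ≤ ε * n) :
    edist (stepEmbedding Y n ω) (markovEmbedding hN Y n ω) ≤ 2 * ε := by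
  have hdev' : ∀ u : ℝ≥0, u ≤ 1 → |(N (n * u) ω : ℝ) - n * u| ≤ ε * n := fun u hu => by
    simpa using hdev (n * u) (mul_le_of_le_one_right zero_le hu)
  have hone : (ε : ℝ≥0∞) ≤ 2 * ε := by
    rw [two_mul]
    exact le_self_add
  refine (SkorokhodSpace.edist_stepPath_subordinate_le (fun k => Y k ω) hc hn hdev'
    (C := 2 * ε) ?_).trans (max_le le_rfl ?_)
  · simp only [mul_one]
    intro j hj hj'
    have hex : ∀ i, min (n - 1) (N n ω) ≤ i → i + 1 ≤ max (n - 1) (N n ω) →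
        edist (Y i ω) (Y (min (n - 1) (N n ω)) ω) ≤ ε := by
      intro i hi hi'
      rw [← hcount] at hi hi' ⊢
      exact edist_le_of_extraSteps_lt hextra hi hi' hn
    rcases Nat.lt_or_ge j (max (n - 1) (N n ω)) with h | h
    · exact (hex j hj h).trans hone
    · rcases Nat.lt_or_ge (N n ω) n with h1 | h1
      · rcases Nat.lt_or_ge (N n ω) (n - 1) with h2 | h2
        -- The Poisson clock falls short and the uncovered index is `n - 1`. The detour through `Y
        -- (n - 2)`, which is covered, accounts for the factor `2` in the bound.
        · obtain rfl : j = n - 1 := by omega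
          rw [two_mul]
          refine (edist_triangle _ (Y (n - 2) ω) _).trans (add_le_add ?_ ?_)
          · rwa [edist_comm]
          · exact hex _ (by omega) (by omega)
        · rw [show j = min (n - 1) (N n ω) by omega, edist_self]
          exact zero_le
      · have := hover h1 (N n ω - (n - 1)) le_rfl
        rw [show min (n - 1) (N n ω) = n - 1 by omega, show j = n - 1 + (N n ω - (n - 1)) by omega,
          edist_nndist, nndist_eq_nnnorm]
        exact le_trans (by exact_mod_cast this) hone
  · rw [ENNReal.ofReal_coe_nnreal]
    exact hone

variable [SecondCountableTopology E] [MeasurableSpace E] [BorelSpace E]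

/-- The increment of the chain over the very last of the extra steps of the Poisson clock is
negligible as well: adjacent values of a Poisson count have comparable probabilities. -/
theorem measure_overshoot_le (hN : IsPoissonProcess 1 N P) {Y : ℕ → Ω → E}
    (hindep : IndepFun (fun ω k => Y k ω) (fun ω t => N t ω) P) (hY : ∀ k, Measurable (Y k))
    {n : ℕ} (hn : 0 < n) (ε : ℝ≥0) :
    P {ω | n ≤ N n ω ∧ N n ω ≤ 2 * n ∧
        ∃ k ≤ N n ω - (n - 1), ε ≤ ‖Y (n - 1 + k) ω - Y (n - 1) ω‖₊}
      ≤ 3 * P {ω | ε ≤ extraSteps Y N n ω} := by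
  -- An event of the chain alone, with the random count replaced by a fixed `m`, so that
  -- independence applies for each `m`.
  let S : ℕ → Set (ℕ → E) := fun m =>
    ⋃ k ∈ Iic (m - (n - 1)), {y | ε ≤ ‖y (n - 1 + k) - y (n - 1)‖₊}
  have hS : ∀ m, MeasurableSet (S m) := fun m =>
    MeasurableSet.biUnion (to_countable _) fun k _ => measurableSet_le measurable_const
      ((Measurable.sub (f := fun y : ℕ → E => y (n - 1 + k)) (g := fun y => y (n - 1))
        (measurable_pi_apply _) (measurable_pi_apply _)).nnnorm)
  let A : ℕ → Set Ω := fun m => (fun ω k => Y k ω) ⁻¹' S m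
  let B : ℕ → Set Ω := fun m => {ω | N n ω ∈ ({m} : Set ℕ)}
  have hA : ∀ m, MeasurableSet (A m) := fun m => measurable_pi_iff.2 hY (hS m)
  have hB : ∀ m, MeasurableSet (B m) := fun m => hN.measurable n (measurableSet_singleton m)
  have hAB : ∀ m l, P (A m ∩ B l) = P (A m) * P (B l) := fun m l =>
    hindep.measure_inter_preimage_eq_mul (S m) {c | c n ∈ ({l} : Set ℕ)} (hS m)
      (measurable_pi_apply (n : ℝ≥0) (measurableSet_singleton l))
  have hsub1 : {ω | n ≤ N n ω ∧ N n ω ≤ 2 * n ∧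
        ∃ k ≤ N n ω - (n - 1), ε ≤ ‖Y (n - 1 + k) ω - Y (n - 1) ω‖₊}
      ⊆ ⋃ m ∈ Finset.Icc n (2 * n), A m ∩ B m := by
    rintro ω ⟨h1, h2, k, hk, hk'⟩
    simp only [mem_iUnion, Finset.mem_Icc, exists_prop]
    exact ⟨N n ω, ⟨h1, h2⟩, mem_biUnion (mem_Iic.2 hk) hk', rfl⟩
  -- If `N n = m + 1`, the supremum in `extraSteps` runs over `k < m + 1 - (n - 1)`, which is
  -- exactly `k ≤ m - (n - 1)`.
  have hsub2 : (⋃ m ∈ Finset.Icc n (2 * n), A m ∩ B (m + 1) : Set Ω) ≤ᵐ[P]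
      ({ω | ε ≤ extraSteps Y N n ω} : Set Ω) := by
    filter_upwards [hN.ae_countBefore_eq (show (0 : ℝ≥0) < n by exact_mod_cast hn)] with ω hω h
    obtain ⟨m, hm, hAm, hBm⟩ := mem_iUnion₂.1 h
    obtain ⟨k, hk, hk'⟩ := mem_iUnion₂.1 hAm
    have hBm' : N n ω = m + 1 := hBm
    have hm1 := (Finset.mem_Icc.1 hm).1
    have hk1 : k ≤ m - (n - 1) := hk
    change ε ≤ extraSteps Y N n ω
    rw [extraSteps, hω, hBm', show min (n - 1) (m + 1) = n - 1 by omega]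
    refine le_trans hk' (Finset.le_sup (f := fun k => ‖Y (n - 1 + k) ω - Y (n - 1) ω‖₊) ?_)
    rw [Finset.mem_range]
    omega
  have hdisj : ((Finset.Icc n (2 * n) : Finset ℕ) : Set ℕ).PairwiseDisjoint
      fun m => A m ∩ B (m + 1) := by
    intro m _ l _ hml
    refine Set.disjoint_left.2 fun ω h1 h2 => hml ?_
    have e1 : N n ω = m + 1 := h1.2
    have e2 : N n ω = l + 1 := h2.2
    omega
  calc _ ≤ ∑ m ∈ Finset.Icc n (2 * n), P (A m ∩ B m) :=
        (measure_mono hsub1).trans (measure_biUnion_finset_le _ _)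
    _ ≤ ∑ m ∈ Finset.Icc n (2 * n), 3 * P (A m ∩ B (m + 1)) := by
        refine Finset.sum_le_sum fun m hm => ?_
        rw [hAB, hAB, mul_left_comm]
        gcongr
        exact measure_count_le_three_mul_succ hN hn (Finset.mem_Icc.1 hm).2
    _ = 3 * P (⋃ m ∈ Finset.Icc n (2 * n), A m ∩ B (m + 1)) := by
        rw [← Finset.mul_sum, measure_biUnion_finset hdisj fun m _ => (hA m).inter (hB (m + 1))]
    _ ≤ _ := mul_le_mul_right (measure_mono_ae hsub2) 3

theorem tendsto_measure_edist_embeddings (hN : IsPoissonProcess 1 N P) {Y : ℕ → ℕ → Ω → E}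
    (hY : ∀ n k, Measurable (Y n k))
    (hindep : ∀ n, IndepFun (fun ω k => Y n k ω) (fun ω t => N t ω) P)
    (hextra : TendstoInMeasure P (fun n => extraSteps (Y n) N n) atTop (fun _ => 0))
    (hlast : ∀ ε : ℝ≥0, 0 < ε →
      Tendsto (fun n => P {ω | ε ≤ edist (Y n (n - 2) ω) (Y n (n - 1) ω)}) atTop (𝓝 0))
    {a : ℝ≥0∞} (ha : 0 < a) :
    Tendsto (fun n => P {ω | a ≤ edist (stepEmbedding (Y n) n ω) (markovEmbedding hN (Y n) n ω)})
      atTop (𝓝 0) := by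
  obtain ⟨b, hb0, hba⟩ := ENNReal.lt_iff_exists_nnreal_btwn.1 ha
  have hb0' : 0 < b := by exact_mod_cast hb0
  -- The bound `b / 2` makes `2 * ε < a`; the bound `1` makes a deviation of at most `ε * n` imply
  -- `N n ≤ 2 * n`.
  set ε : ℝ≥0 := min (b / 2) 1 with hε
  have hε0 : 0 < ε := lt_min (by positivity) one_pos
  have hεb : 2 * (ε : ℝ≥0∞) < a := by
    refine lt_of_le_of_lt ?_ hba
    have : 2 * ε ≤ b := by
      have := mul_le_mul_right (min_le_left (b / 2) 1) 2
      rwa [mul_div_cancel₀ b two_ne_zero] at this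
    exact_mod_cast this
  have hext : Tendsto (fun n => P {ω | ε ≤ extraSteps (Y n) N n ω}) atTop (𝓝 0) := by
    have := hextra ε (by exact_mod_cast hε0)
    simpa [edist_nndist, NNReal.nndist_zero_eq_val'] using this
  have hdev := hN.tendsto_measure_deviation (show (0 : ℝ) < ε from hε0)
  have hsum := (hext.add (hlast ε hε0)).add (hdev.add (ENNReal.Tendsto.const_mul (a := 3) hext
    (Or.inr (by simp))))
  rw [mul_zero, add_zero, add_zero] at hsum
  refine tendsto_of_tendsto_of_tendsto_of_le_of_le' tendsto_const_nhds hsum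
    (Eventually.of_forall fun _ => zero_le) ?_
  filter_upwards [eventually_gt_atTop 0] with n hn
  have hn0 : (0 : ℝ≥0) < n := by exact_mod_cast hn
  refine le_trans (measure_mono_ae (t := (({ω | ε ≤ extraSteps (Y n) N n ω} ∪
    {ω | ε ≤ edist (Y n (n - 2) ω) (Y n (n - 1) ω)}) ∪
    ({ω | ∃ t : ℝ≥0, t ≤ n ∧ ε * n < |(N t ω : ℝ) - t|} ∪ {ω | n ≤ N n ω ∧ N n ω ≤ 2 * n ∧
        ∃ k ≤ N n ω - (n - 1), ε ≤ ‖Y n (n - 1 + k) ω - Y n (n - 1) ω‖₊}) : Set Ω)) ?_)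
    ((measure_union_le _ _).trans (add_le_add (measure_union_le _ _)
      ((measure_union_le _ _).trans (add_le_add le_rfl
        (measure_overshoot_le hN (hindep n) (hY n) hn ε)))))
  filter_upwards [hN.ae_isSimpleClock n, hN.ae_countBefore_eq hn0] with ω hc hcount hω
  by_contra hcon
  have hω' : a ≤ edist (stepEmbedding (Y n) n ω) (markovEmbedding hN (Y n) n ω) := hω
  obtain ⟨h12, h34⟩ := not_or.1 hcon
  obtain ⟨h1, h2⟩ := not_or.1 h12
  obtain ⟨h3, h4⟩ := not_or.1 h34
  have h3' : ∀ t : ℝ≥0, t ≤ n → |(N t ω : ℝ) - t| ≤ ε * n := fun t ht =>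
    not_lt.1 fun h => h3 ⟨t, ht, h⟩
  have h2n : N n ω ≤ 2 * n := by
    have h5 := (abs_le.1 (h3' n le_rfl)).2
    have h6 : (ε : ℝ) ≤ 1 := by exact_mod_cast min_le_right (b / 2) 1
    have h7 : (0 : ℝ) ≤ n := n.cast_nonneg
    rw [NNReal.coe_natCast] at h5
    have : (N n ω : ℝ) ≤ 2 * n := by nlinarith
    exact_mod_cast this
  refine absurd (edist_stepEmbedding_markovEmbedding_le hN hn hc hcount (not_le.1 h1)
    (not_le.1 h2).le (fun h k hk => ?_) h3') (not_le.2 (hεb.trans_le hω'))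
  exact (not_le.1 fun h' => h4 ⟨h, h2n, k, hk, h'⟩).le

end ExtraSteps

theorem mainTheorem8 {d : ℕ} {Ω : Type*} [MeasurableSpace Ω] (P : Measure Ω)
    [IsProbabilityMeasure P]
    (Y : ℕ → ℕ → Ω → EuclideanSpace ℝ (Fin d))
    (hY : ∀ n, IsHomogeneousMarkovChain (Y n) P)
    (N : ℝ≥0 → Ω → ℕ) (hN : IsPoissonProcess 1 N P)
    (hindep : ∀ n, IndepFun (fun ω k => Y n k ω) (fun ω t => N t ω) P)
    (hextra : TendstoInMeasure P (fun n => extraSteps (Y n) N n) atTop (fun _ => 0)) :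
    ((∃ L : ProbabilityMeasure (SkorokhodSpace (EuclideanSpace ℝ (Fin d))),
        TendstoInDistribution (fun n => stepEmbedding (Y n) n) atTop id (fun _ => P) (L : Measure _)) ↔
      ∃ L : ProbabilityMeasure (SkorokhodSpace (EuclideanSpace ℝ (Fin d))),
        TendstoInDistribution (fun n => markovEmbedding hN (Y n) n) atTop id (fun _ => P)
          (L : Measure _)) ∧
    ∀ L : ProbabilityMeasure (SkorokhodSpace (EuclideanSpace ℝ (Fin d))),
      TendstoInDistribution (fun n => stepEmbedding (Y n) n) atTop id (fun _ => P) (L : Measure _) ↔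
        TendstoInDistribution (fun n => markovEmbedding hN (Y n) n) atTop id (fun _ => P)
          (L : Measure _) := by
  have hX : ∀ n, AEMeasurable (stepEmbedding (Y n) n) P := fun n =>
    (measurable_stepEmbedding (hY n).measurable n).aemeasurable
  have hZ : ∀ n, AEMeasurable (markovEmbedding hN (Y n) n) P := fun n =>
    aemeasurable_markovEmbedding hN (hY n).measurable n
  have key : ∀ L : ProbabilityMeasure (SkorokhodSpace (EuclideanSpace ℝ (Fin d))),
      TendstoInDistribution (fun n => stepEmbedding (Y n) n) atTop id (fun _ => P) (L : Measure _) ↔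
        TendstoInDistribution (fun n => markovEmbedding hN (Y n) n) atTop id (fun _ => P)
          (L : Measure _) := by
    intro L
    constructor
    · intro h
      -- The assumed convergence enters twice: it provides the limit, and it makes the last step
      -- small, without which the two embeddings need not be close.
      refine tendstoInDistribution_of_edist h hZ fun a ha => ?_
      exact tendsto_measure_edist_embeddings hN (fun n => (hY n).measurable) hindep hextra
        (fun ε hε => tendsto_lastStep_of_stepEmbedding h hε) ha
    · intro h
      refine tendstoInDistribution_of_edist h hX fun a ha => ?_
      simp_rw [edist_comm (markovEmbedding hN _ _ _)]
      exact tendsto_measure_edist_embeddings hN (fun n => (hY n).measurable) hindep hextra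
        (fun ε hε => tendsto_lastStep_of_markovEmbedding hN hindep h hε) ha
  exact ⟨exists_congr key, key⟩
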